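/- **Setting.** Let $\mathcal A$ be a min-plus weighted automaton with finite state set $Q$, finite alphabet $\Sigma$, initial state $q_0$ and exactly one weight $\mathrm{wt}(p,\sigma,q)\in\mathbb Z\cup\{\infty\}$ for all $p,\sigma,q$ ($\infty$ means: no transition). Its *augmented construction* has states $S=\{(q,p,T)\mid q,p\in T\subseteq Q\}$ (with $p$ the baseline component; *baseline states* are those with $q=p$), initial state $s_0=(q_0,q_0,\{q_0\})$, and letters the transitions $(q_1,\sigma,c,q_2)$ of $\mathcal A$; if $c<\infty$, the letter leads from $(p_1,q_1,T)$ to $(p_2,q_2,\delta(T,\sigma))$ with weight $\mathrm{wt}(p_1,\sigma,p_2)-c$, where $\delta(T,\sigma)$ is the set of states reachable from $T$ on $\sigma$; all other weights are $\infty$. Let $\mathrm{mwt}(s\xrightarrow{w}t)$ be the minimal weight of a run on $w$ from $s$ to $t$ ($\infty$ if there is none), $\mathbf c_w(t)=\mathrm{mwt}(s_0\xrightarrow{w}t)$, $\delta_{\mathbb B}(s_0,w)=\{t\mid \mathbf c_w(t)<\infty\}$, and $\mathfrak m=|S|\cdot|S|!$. The maximal effect $\|w\|$ is the sum, over the letters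 of $w$, of the maximal absolute value of a finite weight of a transition on the letter. The ghost-reachable set $\delta_{\mathrm{gh}}(s_0,w)$ consists of all states sharing baseline component and third component with a state of $\delta_{\mathbb B}(s_0,w)$. **Cactus letters.** A pair $(S',w)$ is a *stable cycle* if $S'=\{(p,q,T)\mid p\in T\}$ for some $q\in T$, all runs on $w$ from $S'$ end in $S'$, and for every $n\in\mathbb N$ the state $b=(q,q,T)$ has $\mathrm{mwt}(b\xrightarrow{w^n}b)=0$ and lies in $\mathrm{Min}(S',w^n)$, the set of states of $S'$ having a cycle on $w^n$ of least weight among all such cycles of states of $S'$. A pair $(s,r)\in S'\times S'$ is *grounded* if $s\xrightarrow{w^{\mathfrak m}}g\xrightarrow{w^{\mathfrak m}}r$ for some $g\in\mathrm{Min}(S',w^{\mathfrak m})$. The cycle is *degenerate* if $(s,t)$ is grounded for all $s,t\in S'$ such that $t\xrightarrow{w^{2\mathfrak m}}t$ and $s\xrightarrow{w^{2\mathfrak m k}}t$ for some $k\ge1$. For a stable cycle, the *cactus letter* $\alpha_{S',w}$ leads from $s$ to $r$, for $(s,r)$ grounded, with the least weight of a run $s\xrightarrow{w^{\mathfrak m}}g\xrightarrow{w^{\mathfrak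 m}}r$ over all such $g$ (and weight $\infty$ otherwise); words may again contain cactus letters. For a grounded pair $s=(q_1,p,T)$, $r=(q_2,p,T)$ of $(S',w)$ with $\alpha_{S',w}$-weight $c$, the *rebase letter* $\beta_{S',w,s\to r}$ leads from $(q',q_1,T)$ to $(q'',q_2,T)$ with weight $d-c$, where $d$ is the $\alpha_{S',w}$-weight from $(q',p,T)$ to $(q'',p,T)$. The *jump letter* from $(q,p_1,T)$ to $(q,p_2,T)$ leads from $(q',p_1,T)$ to $(q',p_2,T)$ with weight $0$ for all $q'\in T$. The depth is $0$ for base letters, $1+\mathrm{dep}(w)$ for $\alpha_{S',w}$ and $\beta_{S',w,s\to r}$, and the maximum over the letters for words. **Length bounds.** Let $N=|S|$, and let $\mathsf R(k)$ be the Ramsey number for $k$-colourings of pairs and homogeneous sets of size $3$. For parameters $h\in\mathbb N$, $i_0\in\{0,1\}$ define $\mathsf{Len}(0,i)=1$, $\mathsf{Len}(d,N+1)=1$, $\mathsf{Cov}(d,N)=1$, $\mathsf W(0)$ = the maximal absolute value of a finite transition weight of the augmented construction, and $$\begin{aligned} \mathsf{Len}(d{+}1,i)&=32\mathfrak m^2\,\mathsf{Len}(d,1)\,\mathsf{Len}(d{+}1,i{+}1)\,\bigl(\mathsf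 R(\mathsf{Typ}(d{+}1,i))+2\bigr)^{2\mathsf{Amp}(d+1,i)+1},\\ \mathsf{Cov}(d{+}1,i)&=8\mathfrak m^2\bigl(\mathsf W(d)\,\mathsf{Len}(d,1)\,\mathsf{Len}(d{+}1,i{+}1)+\mathsf{Cov}(d{+}1,i{+}1)+h\bigr),\\ \mathsf W(d{+}1)&=2\mathfrak m\,\mathsf W(d)\,\mathsf{Len}(d{+}1,i_0),\qquad \mathsf{Typ}(d{+}1,i)=3^i\bigl(2\,\mathsf{Cov}(d{+}1,i)+2\bigr)^{2Ni},\\ \mathsf{Amp}(d{+}1,i)&=32\mathfrak m^2\bigl(h+2\mathsf W(d)\bigr)\bigl(\mathsf R(\mathsf{Typ}(d{+}1,i))+\mathsf{Len}(d{+}1,i{+}1)+\mathsf{Len}(d,1)\bigr). \end{aligned}$$ The *simple* functions are those with $h=0$, $i_0=1$. Let $\mathbf H$ be the value $\mathsf{Amp}(N,0)$ of the simple functions; the *general* functions are those with $h=\mathbf H$, $i_0=0$. For $f\in\{\mathrm{simp},\mathrm{gen}\}$ put $L_f(d)=\mathsf{Len}(d,1)$ for the respective functions. **Alphabets.** $\mathsf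 C_f$ is the set of letters of depth at most $|S|-1$ built hereditarily from the base letters and the letters $\alpha_{S',w}$, where $w$ is a word of such letters, $(S',w)$ is a non-degenerate stable cycle and $|w|\le L_f(\mathrm{dep}(w)+1)$. $\mathsf{CR}_f$ adds the rebase letters $\beta_{S',w,s\to r}$ with $\alpha_{S',w}\in\mathsf C_f$; $\mathsf{CRJ}_f$ adds to $\mathsf{CR}_f$ all jump letters; $\mathsf{CRC}_f$ is the set of $\alpha_{S',w}$ with $w\in\mathsf{CR}_f^*$, $(S',w)$ a stable cycle and $|w|\le L_f(\mathrm{dep}(w)+1)$. **Potential, charge, witnesses.** A *seamless baseline run* on $w$ is a run from $s_0$ through baseline states whose weight after each prefix is the minimal weight of reaching its current state by that prefix. A state $q$ with $\mathbf c(q)<\infty$ is *dominant* in a configuration $\mathbf c$ if there is $z\in\mathsf{CRJ}_{\mathrm{simp}}^*\cdot\mathsf{CRC}_{\mathrm{gen}}$ that has a run from $q$, but from no $p$ with $\mathbf c(p)<\mathbf c(q)$. For $w$ with a seamless baseline run, the potential $\varphi(w)$ is the maximal value $\mathbf c_w(q)$ of a dominant state $q$ of $\mathbf c_w$, and the charge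 is $\psi(w)=-\min_q\mathbf c_w(q)$. A *type-0 witness over $\mathsf C_g$* is a triple $w_1,\alpha_{S_1,w_2},w_3$ with $w_1\in\mathsf C_g^*$, $S_1=\delta_{\mathrm{gh}}(s_0,w_1)$, $\alpha_{S_1,w_2}\in\mathsf C_g$, $w_3\in(\mathsf C_g\cup\mathsf{CRJ}_{\mathrm{simp}})^*\cdot\mathsf{CRC}_{\mathrm{gen}}$, $\delta_{\mathbb B}(s_0,w_1)=\delta_{\mathbb B}(s_0,w_1w_2^{2\mathfrak m})$, such that $w_1w_2^{2\mathfrak m}w_3$ has a run from $s_0$ but $w_1\alpha_{S_1,w_2}w_3$ has none. For $g=\mathrm{simp}$ this is called simply a *type-0 witness* (then $\mathsf C_g\subseteq\mathsf{CRJ}_{\mathrm{simp}}$). **SRIs.** A word $uxyv\in\mathsf C_f^*$ is a *separated repeating infix* w.r.t. $f$ if (1) $\delta_{\mathbb B}(s_0,u)=\delta_{\mathbb B}(s_0,ux)=\delta_{\mathbb B}(s_0,uxy)=:B$; (2) $|x|\le\frac1{\mathfrak m}L_f(\mathrm{dep}(x)+1)$; (3) with $G=4|S|\mathfrak m\|xy\|$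 (plus $\mathbf H$ if $f=\mathrm{gen}$), $B$ has a partition $V_1,\dots,V_\ell$ into nonempty sets such that $\mathbf c_\xi(s')-\mathbf c_\xi(s)>G$ for $s\in V_j$, $s'\in V_{j+1}$, $\xi\in\{u,ux,uxy\}$, and for each $j$ there are integers $k_{j,x},k_{j,y}$ of the same sign with $\mathbf c_{ux}=\mathbf c_u+k_{j,x}$ and $\mathbf c_{uxy}=\mathbf c_{ux}+k_{j,y}$ on $V_j$; (4) there is a seamless baseline run on $uxyv$. It is a *simple SRI* if $f=\mathrm{simp}$, $\varphi(u)\le\varphi(ux)\le\varphi(uxy)$ and $\varphi(u)=\varphi(ux)\iff\varphi(ux)=\varphi(uxy)$; it is a *general SRI* if $f=\mathrm{gen}$, $\psi(u)\ge\psi(ux)\ge\psi(uxy)$ and $\psi(u)=\psi(ux)\iff\psi(ux)=\psi(uxy)$. It is *non-degenerate stable* if $(\delta_{\mathrm{gh}}(s_0,u),x)$ is a stable cycle that is not degenerate. **Statement.** Let $w=uxyv$ be a non-degenerate stable SRI (simple or general), with flavour $f$, and let $w'=u\,\alpha_{\delta_{\mathrm{gh}}(s_0,u),x}\,v$. Then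 $w'\in\mathsf C_f^*$, $w'$ has a seamless baseline run, and: 1. $\mathrm{mwt}(s_0\xrightarrow{w}t)\le\mathrm{mwt}(s_0\xrightarrow{w'}t)$ for every $t\in S$; 2. $\psi(w)\ge\psi(w')$; 3. for every $g\in\{\mathrm{simp},\mathrm{gen}\}$ such that $w$ and $w'$ are words over $\mathsf C_g$ (in particular for $g=f$): either there is a type-0 witness over $\mathsf C_g$, or $\varphi(w)\le\varphi(w')$. In particular, if $w$ is a simple SRI, then either there is a type-0 witness or $\varphi(w)\le\varphi(w')$. -/

import Mathlib

noncomputable section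

/-- A min-plus weighted finite automaton. `weight p σ q` is the weight of the unique transition
from `p` to `q` on `σ`; the value `⊤` (infinity) means that there is no transition. -/
structure WFA (Q Γ : Type*) where
  init : Q
  weight : Q → Γ → Q → WithTop ℤ

/-- The states `(q, p, T)` of the baseline-augmented subset construction, with `q, p ∈ T`. -/
abbrev AugState (Q : Type*) : Type _ :=
  {s : Q × Q × Finset Q // s.1 ∈ s.2.2 ∧ s.2.1 ∈ s.2.2}

namespace AugState

variable {Q : Type*}

/-- The inner state. -/
def inner (s : AugState Q) : Q := s.1.1

/-- The baseline component. -/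
def base (s : AugState Q) : Q := s.1.2.1

/-- The reachable subset. -/
def reach (s : AugState Q) : Finset Q := s.1.2.2

/-- `s` is a baseline state, i.e. of the form `(p, p, T)`. -/
def IsBaseline (s : AugState Q) : Prop := s.inner = s.base

/-- The baseline shift of `t` to the baseline component of `s` (which has the same reachable
subset): if `t = (p, _, T)` and `s = (_, q, T)`, this is `(p, q, T)`. -/
def withBase (t s : AugState Q) (h : t.reach = s.reach) : AugState Q :=
  ⟨(t.inner, s.base, s.reach), by
    refine ⟨?_, s.2.2⟩
    have h1 : t.inner ∈ t.reach := t.2.1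
    rw [h] at h1
    exact h1⟩

end AugState

/-- Letters: `base p σ q` is the transition of the given WFA from `p` to `q` on `σ` (its weight is
determined by the WFA), `cactus S' w` is `α_{S', w}`, `rebase S' w s r` is `β_{S', w, s → r}` and
`jump s r` is the jump letter from `s` to `r`. These are raw letters; which of them are legal is
determined by the alphabets `boundedCac`, `boundedCacReb`, ... below. -/
inductive Letter (Q Γ : Type*)
  | base (p : Q) (σ : Γ) (q : Q) : Letter Q Γ
  | cactus (S' : Finset (AugState Q)) (w : List (Letter Q Γ)) : Letter Q Γ
  | rebase (S' : Finset (AugState Q)) (w : List (Letter Q Γ)) (s r : AugState Q) : Letter Q Γ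
  | jump (s r : AugState Q) : Letter Q Γ

mutual

/-- The depth of a letter. -/
def Letter.depth {Q Γ : Type*} : Letter Q Γ → ℕ
  | .base _ _ _ => 0
  | .cactus _ w => 1 + wordDepth w
  | .rebase _ w _ _ => 1 + wordDepth w
  | .jump _ _ => 0

/-- The depth of a word: the maximal depth of its letters. -/
def wordDepth {Q Γ : Type*} : List (Letter Q Γ) → ℕ
  | [] => 0
  | a :: w => max (Letter.depth a) (wordDepth w)

end

/-! ### Min-plus matrices -/

section Cost

variable {α : Type*} [Fintype α]

/-- The minimal weights of runs on the empty word. -/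
def costOne [DecidableEq α] : α → α → WithTop ℤ := fun s r => if s = r then 0 else ⊤

/-- The minimal weights of runs on a concatenation. -/
def costMul (W V : α → α → WithTop ℤ) : α → α → WithTop ℤ :=
  fun s r => Finset.univ.inf fun t => W s t + V t r

/-- If `W` gives the minimal weights of runs on `w`, then `costPow W n` gives the minimal weights
of runs on `w ^ n` (see `WFA.mwt_pow`). -/
def costPow [DecidableEq α] (W : α → α → WithTop ℤ) : ℕ → α → α → WithTop ℤ
  | 0 => costOne
  | n + 1 => costMul W (costPow W n)

theorem costOne_mul [DecidableEq α] (W : α → α → WithTop ℤ) : costMul costOne W = W := by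
  funext s r
  apply le_antisymm
  · refine (Finset.inf_le (Finset.mem_univ s)).trans ?_
    simp [costOne]
  · refine Finset.le_inf fun t _ => ?_
    by_cases h : s = t
    · subst h; simp [costOne]
    · simp [costOne, h]

theorem add_inf_univ (a : WithTop ℤ) (f : α → WithTop ℤ) :
    a + Finset.univ.inf f = Finset.univ.inf fun t => a + f t := by
  have := Finset.apply_inf_eq_inf_comp_of_linearOrder (s := (Finset.univ : Finset α)) (f := f)
    (fun b : WithTop ℤ => a + b) (fun _ _ h => by dsimp only; gcongr) (by simp)
  simpa [Function.comp_def] using this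

theorem inf_univ_add (a : WithTop ℤ) (f : α → WithTop ℤ) :
    Finset.univ.inf f + a = Finset.univ.inf fun t => f t + a := by
  rw [add_comm, add_inf_univ]
  simp only [add_comm]

theorem costMul_assoc (U V W : α → α → WithTop ℤ) :
    costMul (costMul U V) W = costMul U (costMul V W) := by
  funext s r
  simp only [costMul, inf_univ_add, add_inf_univ]
  rw [Finset.inf_comm]
  simp only [add_assoc]

end Cost

section Stab

variable {Q : Type*} [Fintype Q] [DecidableEq Q]

/-- The stabilisation constant `|S| * |S|!`. -/
def bigM (Q : Type*) [Fintype Q] [DecidableEq Q] : ℕ :=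
  Fintype.card (AugState Q) * (Fintype.card (AugState Q)).factorial

/-! In the following definitions `W` is the matrix of minimal weights of the runs on a word `w`. -/

/-- The minimal reflexive states `MinStates(S', w)`: states of `S'` with a cycle on `w`, whose
minimal weight is least among all states of `S'` with a cycle on `w`. -/
def minStates (S' : Finset (AugState Q)) (W : AugState Q → AugState Q → WithTop ℤ) :
    Finset (AugState Q) :=
  S'.filter fun s => W s s ≠ ⊤ ∧ ∀ r ∈ S', W r r ≠ ⊤ → W s s ≤ W r r

/-- `(S', w)` is a stable cycle: `S' = {(p, q, T) | p ∈ T}` for some `q ∈ T` (so that `b` is the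
state `(q, q, T)`), `w` leads from `S'` back to `S'`, and for all `n` the baseline state is a
minimal reflexive state of `(S', w ^ n)` whose minimal cycle has weight `0`. -/
def IsStableCycle (S' : Finset (AugState Q)) (W : AugState Q → AugState Q → WithTop ℤ) : Prop :=
  ∃ b : AugState Q, b.IsBaseline ∧
    (∀ s, s ∈ S' ↔ s.base = b.base ∧ s.reach = b.reach) ∧
    (∀ s ∈ S', ∀ r, W s r ≠ ⊤ → r ∈ S') ∧
    ∀ n : ℕ, b ∈ minStates S' (costPow W n) ∧ costPow W n b b = 0

/-- `(s, r)` is a grounded pair of `(S', w)`. -/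
def IsGrounded (S' : Finset (AugState Q)) (W : AugState Q → AugState Q → WithTop ℤ)
    (s r : AugState Q) : Prop :=
  s ∈ S' ∧ r ∈ S' ∧ ∃ g ∈ minStates S' (costPow W (bigM Q)),
    costPow W (bigM Q) s g ≠ ⊤ ∧ costPow W (bigM Q) g r ≠ ⊤

/-- `(S', w)` is degenerate (for stable cycles). -/
def IsDegenerate (S' : Finset (AugState Q)) (W : AugState Q → AugState Q → WithTop ℤ) : Prop :=
  ∀ s ∈ S', ∀ t ∈ S', costPow W (2 * bigM Q) t t ≠ ⊤ →
    (∃ k : ℕ, 1 ≤ k ∧ costPow W (2 * bigM Q * k) s t ≠ ⊤) → IsGrounded S' W s t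

/-- The transitions on the cactus letter `α_{S', w}`: grounded pairs are joined by the minimal
weight of a run on `w ^ m · w ^ m` through a state of `MinStates(S', w ^ m)`, all other pairs
get weight `⊤`. -/
def stabCost (S' : Finset (AugState Q)) (W : AugState Q → AugState Q → WithTop ℤ) :
    AugState Q → AugState Q → WithTop ℤ := fun s r =>
  if s ∈ S' ∧ r ∈ S' then
    (minStates S' (costPow W (bigM Q))).inf fun g =>
      costPow W (bigM Q) s g + costPow W (bigM Q) g r
  else ⊤

/-- The transitions on `β_{S', w, s → r}`, where `C` are those on `α_{S', w}`. For
`s = (q₁, p, T)`, `r = (q₂, p, T)` and `c = C s r`, there is a transition from `(q', q₁, T)` to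
`(q'', q₂, T)` of weight `d - c`, where `d` is the weight of `α_{S', w}` from `(q', p, T)`
to `(q'', p, T)`. -/
def rebaseCost (C : AugState Q → AugState Q → WithTop ℤ) (s r : AugState Q) :
    AugState Q → AugState Q → WithTop ℤ := fun t t' =>
  if h : t.reach = s.reach ∧ t'.reach = r.reach then
    if t.base = s.inner ∧ t'.base = r.inner then
      C (t.withBase s h.1) (t'.withBase r h.2) + ((-((C s r).untopD 0) : ℤ) : WithTop ℤ)
    else ⊤
  else ⊤

/-- The transitions on the jump letter from `s = (q, p₁, T)` to `r = (q, p₂, T)`: from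
`(q', p₁, T)` to `(q', p₂, T)` with weight `0`. -/
def jumpCost (s r : AugState Q) : AugState Q → AugState Q → WithTop ℤ := fun t t' =>
  if t.base = s.base ∧ t.reach = s.reach ∧ t'.base = r.base ∧ t'.reach = r.reach ∧
    t.inner = t'.inner then 0 else ⊤

end Stab

/-! ### The length functions -/

/-- The least `R` such that every colouring of the two-element subsets of an `R`-element set with
`k` colours has a homogeneous set with (at least) `n` elements. -/
def ramseyNumber (k n : ℕ) : ℕ :=
  sInf {R : ℕ | ∀ col : Sym2 (Fin R) → Fin k, ∃ H : Finset (Fin R), n ≤ H.card ∧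
    ∃ c : Fin k, ∀ i ∈ H, ∀ j ∈ H, i ≠ j → col s(i, j) = c}

/-- The parameters on which the length functions depend: the number `n` of states of the augmented
construction, the stabilisation constant `m`, the maximal weight `w₀` of a transition of the
augmented construction, the additive constant `h` (`0` for the simple functions), and the second
index `i₀` at which `maxWt` uses `len`. -/
structure LenParams where
  n : ℕ
  m : ℕ
  w₀ : ℕ
  h : ℕ
  i₀ : ℕ

namespace LenParams

/-! The functions `len(d, i)`, `cover(d, i)`, `maxWt(d)`, `amp(d, i)` and `types(d, i)`. The recursion
decreases `d` and increases `i` up to `n + 1`; `len(d, n + 1) = 1` and `cover(d, n) = 1`. -/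

mutual

def len (P : LenParams) (d i : ℕ) : ℕ :=
  match d with
  | 0 => 1
  | d + 1 =>
    if P.n < i then 1
    else 32 * P.m ^ 2 * P.len d 1 * P.len (d + 1) (i + 1) *
      (ramseyNumber (P.types (d + 1) i) 3 + 2) ^ (2 * P.amp (d + 1) i + 1)
termination_by (d, P.n + 1 - i, 4)

def cover (P : LenParams) (d i : ℕ) : ℕ :=
  match d with
  | 0 => 1
  | d + 1 =>
    if P.n ≤ i then 1
    else 8 * P.m ^ 2 *
      (P.maxWt d * P.len d 1 * P.len (d + 1) (i + 1) + P.cover (d + 1) (i + 1) + P.h)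
termination_by (d, P.n + 1 - i, 1)

def maxWt (P : LenParams) (d : ℕ) : ℕ :=
  match d with
  | 0 => P.w₀
  | d + 1 => 2 * P.m * P.maxWt d * P.len (d + 1) P.i₀
termination_by (d, P.n + 2, 0)

/-- Only used for positive first argument. -/
def amp (P : LenParams) (d i : ℕ) : ℕ :=
  match d with
  | 0 => 0
  | d + 1 =>
    if P.n < i then 0
    else 32 * P.m ^ 2 * (P.h + 2 * P.maxWt d) *
      (ramseyNumber (P.types (d + 1) i) 3 + P.len (d + 1) (i + 1) + P.len d 1)
termination_by (d, P.n + 1 - i, 3)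

/-- Only used for positive first argument. -/
def types (P : LenParams) (d i : ℕ) : ℕ :=
  match d with
  | 0 => 0
  | d + 1 => 3 ^ i * (2 * P.cover (d + 1) i + 2) ^ (2 * P.n * i)
termination_by (d, P.n + 1 - i, 2)

end

end LenParams

/-- The two variants (for potential and for charge) of bounded alphabets and repeating infixes. -/
inductive Flavour
  | simple
  | general

namespace WFA

variable {Q Γ : Type*} [Fintype Q] [DecidableEq Q]

/-! ### The augmented construction and its cactus extension -/

/-- The set of states reachable from `T` on `σ`. -/
def boolStep (A : WFA Q Γ) (T : Finset Q) (σ : Γ) : Finset Q :=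
  Finset.univ.filter fun q => ∃ p ∈ T, A.weight p σ q ≠ ⊤

/-- Transitions of the augmented construction on the letter `(q₁, σ, c, q₂)`: from
`(p₁, q₁, T)` to `(p₂, q₂, δ(T, σ))` with weight `c' - c`, where `c'` is the weight from
`p₁` to `p₂` on `σ`. If `c = ⊤`, there are no transitions. -/
def baseCost (A : WFA Q Γ) (q₁ : Q) (σ : Γ) (q₂ : Q) :
    AugState Q → AugState Q → WithTop ℤ := fun s r =>
  if A.weight q₁ σ q₂ ≠ ⊤ ∧ s.base = q₁ ∧ r.base = q₂ ∧ r.reach = A.boolStep s.reach σ then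
    A.weight s.inner σ r.inner + ((-((A.weight q₁ σ q₂).untopD 0) : ℤ) : WithTop ℤ)
  else ⊤

mutual

/-- The weights of the transitions on a letter in the cactus extension. -/
def letterCost (A : WFA Q Γ) : Letter Q Γ → AugState Q → AugState Q → WithTop ℤ
  | .base p σ q => A.baseCost p σ q
  | .cactus S' w => stabCost S' (mwt A w)
  | .rebase S' w s r => rebaseCost (stabCost S' (mwt A w)) s r
  | .jump s r => jumpCost s r

/-- `A.mwt w s r` is the minimal weight of a run on `w` from `s` to `r`; it is `⊤` if there is no
such run (see `WFA.mwt_eq_coe_iff`). -/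
def mwt (A : WFA Q Γ) : List (Letter Q Γ) → AugState Q → AugState Q → WithTop ℤ
  | [] => costOne
  | a :: w => costMul (letterCost A a) (mwt A w)

end

/-- `A.IsRun w s r c`: there is a run on `w` from `s` to `r` of weight `c`. -/
inductive IsRun (A : WFA Q Γ) : List (Letter Q Γ) → AugState Q → AugState Q → ℤ → Prop
  | nil (s : AugState Q) : IsRun A [] s s 0
  | cons {a : Letter Q Γ} {w : List (Letter Q Γ)} {s t r : AugState Q} {c d : ℤ} :
      A.letterCost a s t = (c : WithTop ℤ) → IsRun A w t r d → IsRun A (a :: w) s r (c + d)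

theorem mwt_append (A : WFA Q Γ) (w w' : List (Letter Q Γ)) :
    A.mwt (w ++ w') = costMul (A.mwt w) (A.mwt w') := by
  induction w with
  | nil => simp [mwt, costOne_mul]
  | cons a w ih => simp [mwt, ih, costMul_assoc]

theorem mwt_pow (A : WFA Q Γ) (w : List (Letter Q Γ)) (n : ℕ) :
    A.mwt (List.replicate n w).flatten = costPow (A.mwt w) n := by
  induction n with
  | zero => simp [mwt, costPow]
  | succ n ih => simp [List.replicate_succ, mwt_append, ih, costPow]

theorem mwt_le_of_isRun (A : WFA Q Γ) {w : List (Letter Q Γ)} {s r : AugState Q} {c : ℤ}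
    (h : A.IsRun w s r c) : A.mwt w s r ≤ c := by
  induction h with
  | nil s => simp [mwt, costOne]
  | @cons a w s t r c d h1 _ ih =>
    rw [mwt]
    refine (Finset.inf_le (Finset.mem_univ t)).trans ?_
    rw [h1, WithTop.coe_add]
    gcongr

theorem isRun_of_mwt (A : WFA Q Γ) {w : List (Letter Q Γ)} {s r : AugState Q} {c : ℤ}
    (h : A.mwt w s r = c) : A.IsRun w s r c := by
  induction w generalizing s c with
  | nil =>
    by_cases hsr : s = r
    · subst hsr
      have : c = 0 := by simpa [mwt, costOne, eq_comm] using h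
      subst this
      exact .nil s
    · simp [mwt, costOne, hsr] at h
  | cons a w ih =>
    rw [mwt] at h
    obtain ⟨t, -, ht⟩ := Finset.exists_mem_eq_inf (Finset.univ : Finset (AugState Q)) ⟨s, by simp⟩
      (fun t => A.letterCost a s t + A.mwt w t r)
    have h2 : A.letterCost a s t + A.mwt w t r = c := by rw [← ht]; exact h
    obtain ⟨x, y, hx, hy, rfl⟩ := WithTop.add_eq_coe.1 h2
    exact .cons hx.symm (ih hy.symm)

theorem mwt_eq_coe_iff (A : WFA Q Γ) (w : List (Letter Q Γ)) (s r : AugState Q) (c : ℤ) :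
    A.mwt w s r = c ↔ IsLeast {d : ℤ | A.IsRun w s r d} c := by
  constructor
  · intro h
    refine ⟨A.isRun_of_mwt h, fun d hd => ?_⟩
    have := A.mwt_le_of_isRun hd
    rw [h] at this
    exact_mod_cast this
  · rintro ⟨h1, h2⟩
    have h3 := A.mwt_le_of_isRun h1
    obtain ⟨d, hd⟩ := WithTop.ne_top_iff_exists.1 (ne_top_of_le_ne_top WithTop.coe_ne_top h3)
    rw [← hd] at h3 ⊢
    have h4 : c ≤ d := h2 (A.isRun_of_mwt hd.symm)
    exact congrArg _ (le_antisymm (by exact_mod_cast h3) h4)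

/-- The initial state `(q₀, q₀, {q₀})`. -/
def augInit (A : WFA Q Γ) : AugState Q :=
  ⟨(A.init, A.init, {A.init}), by simp⟩

/-- The configuration reached by reading `w` from the initial state. -/
def xconf (A : WFA Q Γ) (w : List (Letter Q Γ)) : AugState Q → WithTop ℤ :=
  A.mwt w A.augInit

/-- The states reachable from the initial state by reading `w` (the support of `A.xconf w`). -/
def reachable (A : WFA Q Γ) (w : List (Letter Q Γ)) : Finset (AugState Q) :=
  Finset.univ.filter fun s => A.xconf w s ≠ ⊤

/-- The ghost-reachable states: all states that share the baseline component and the reachable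
subset with a state reachable by `w`. -/
def ghost (A : WFA Q Γ) (w : List (Letter Q Γ)) : Finset (AugState Q) :=
  Finset.univ.filter fun s => ∃ r ∈ A.reachable w, s.base = r.base ∧ s.reach = r.reach

/-- The maximal absolute value of the (finite) weight of a transition on `a`. -/
def letterMaxWeight (A : WFA Q Γ) (a : Letter Q Γ) : ℕ :=
  Finset.univ.sup fun s => Finset.univ.sup fun r => ((A.letterCost a s r).untopD 0).natAbs

/-- The maximal effect of a word. -/
def maxEff (A : WFA Q Γ) (w : List (Letter Q Γ)) : ℕ :=
  (w.map A.letterMaxWeight).sum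

/-- There is a seamless baseline run on `w` from the initial state: `ρ i` is the state of the run
after `i` letters, all of these are baseline states, and after each prefix the weight of the run is
the minimal weight with which its current state is reached. -/
def HasSeamlessBaseline (A : WFA Q Γ) (w : List (Letter Q Γ)) : Prop :=
  ∃ ρ : ℕ → AugState Q, ρ 0 = A.augInit ∧
    (∀ i ≤ w.length, (ρ i).IsBaseline) ∧
    (∀ i : Fin w.length, A.letterCost (w.get i) (ρ i) (ρ (i + 1)) ≠ ⊤) ∧
    ∀ j ≤ w.length,
      ∑ i : Fin w.length with i.val < j, A.letterCost (w.get i) (ρ i) (ρ (i + 1)) =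
        A.xconf (w.take j) (ρ j)

/-- The charge of `w`: minus the minimal weight with which a state is reached. -/
def charge (A : WFA Q Γ) (w : List (Letter Q Γ)) : ℤ :=
  -((Finset.univ.inf (A.xconf w)).untopD 0)

/-! ### Bounded alphabets -/

variable [Fintype Γ]

/-- The parameters of the simple functions. -/
def simpleParams (A : WFA Q Γ) : LenParams where
  n := Fintype.card (AugState Q)
  m := bigM Q
  w₀ := Finset.univ.sup fun t : Q × Γ × Q => A.letterMaxWeight (.base t.1 t.2.1 t.2.2)
  h := 0
  i₀ := 1

/-- The parameters of the simple or general functions. The general ones use the additive constant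
`amp(|S|, 0)` of the simple ones. -/
def params (A : WFA Q Γ) : Flavour → LenParams
  | .simple => A.simpleParams
  | .general => { A.simpleParams with
      h := A.simpleParams.amp (Fintype.card (AugState Q)) 0
      i₀ := 0 }

/-- The length bounds. -/
def lengthBound (A : WFA Q Γ) (f : Flavour) (d : ℕ) : ℕ := (A.params f).len d 1

/-- The letters that are built hereditarily from base letters and cactus letters `α_{S', w}` with
`(S', w)` a non-degenerate stable cycle and `|w|` at most the bound for the depth of the letter. -/
inductive IsBounded (A : WFA Q Γ) (f : Flavour) : Letter Q Γ → Prop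
  | base (p : Q) (σ : Γ) (q : Q) : IsBounded A f (.base p σ q)
  | cactus (S' : Finset (AugState Q)) (w : List (Letter Q Γ)) :
      (∀ a ∈ w, IsBounded A f a) → IsStableCycle S' (A.mwt w) → ¬ IsDegenerate S' (A.mwt w) →
      w.length ≤ A.lengthBound f (wordDepth w + 1) → IsBounded A f (.cactus S' w)

/-- The bounded cactus letters (of depth less than `|S|`). -/
def boundedCac (A : WFA Q Γ) (f : Flavour) : Set (Letter Q Γ) :=
  {a | A.IsBounded f a ∧ a.depth < Fintype.card (AugState Q)}

/-- The bounded cactus letters and their rebase letters. -/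
def boundedCacReb (A : WFA Q Γ) (f : Flavour) : Set (Letter Q Γ) :=
  A.boundedCac f ∪ {a | ∃ S' w s r, a = .rebase S' w s r ∧ .cactus S' w ∈ A.boundedCac f ∧
    IsGrounded S' (A.mwt w) s r}

/-- The cactus letters `α_{S', w}` with `w` a bounded word of bounded cactus and rebase letters. -/
def boundedCacRebCac (A : WFA Q Γ) (f : Flavour) : Set (Letter Q Γ) :=
  {a | ∃ S' w, a = .cactus S' w ∧ (∀ b ∈ w, b ∈ A.boundedCacReb f) ∧
    IsStableCycle S' (A.mwt w) ∧ w.length ≤ A.lengthBound f (wordDepth w + 1)}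

/-- The bounded cactus and rebase letters, and all jump letters. -/
def boundedCacRebJump (A : WFA Q Γ) (f : Flavour) : Set (Letter Q Γ) :=
  A.boundedCacReb f ∪ {a | ∃ s r : AugState Q, a = .jump s r ∧ s.inner = r.inner ∧
    s.reach = r.reach}

/-! ### Dominance, potential and charge -/

/-- `q` is dominant in the configuration `c`: it has finite value, and some suffix (a word of simple
cactus, rebase and jump letters followed by one letter of `boundedCacRebCac general`) can be read
from `q`, but from no state of smaller value. -/
def IsDominant (A : WFA Q Γ) (c : AugState Q → WithTop ℤ) (q : AugState Q) : Prop :=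
  c q ≠ ⊤ ∧ ∃ (z : List (Letter Q Γ)) (a : Letter Q Γ),
    (∀ b ∈ z, b ∈ A.boundedCacRebJump .simple) ∧ a ∈ A.boundedCacRebCac .general ∧
    (∃ t, A.mwt (z ++ [a]) q t ≠ ⊤) ∧
    ∀ p, c p < c q → ∀ t, A.mwt (z ++ [a]) p t = ⊤

/-- The maximal value of a dominant state. -/
def domVal (A : WFA Q Γ) (c : AugState Q → WithTop ℤ) : ℤ :=
  sSup {k : ℤ | ∃ q, A.IsDominant c q ∧ c q = k}

/-- The potential of `w`. -/
def potential (A : WFA Q Γ) (w : List (Letter Q Γ)) : ℤ := A.domVal (A.xconf w)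

/-- A stable cycle on the empty word. -/
theorem isStableCycle_nil (A : WFA Q Γ) (q : AugState Q) :
    IsStableCycle (Finset.univ.filter fun s : AugState Q => s.base = q.base ∧ s.reach = q.reach)
      (A.mwt []) := by
  have hp : ∀ n : ℕ, costPow (A.mwt []) n = costOne := by
    intro n
    rw [← mwt_pow]
    have : (List.replicate n ([] : List (Letter Q Γ))).flatten = [] := by simp
    rw [this, mwt]
  refine ⟨⟨(q.base, q.base, q.reach), q.2.2, q.2.2⟩, rfl, ?_, ?_, ?_⟩
  · intro s
    simp only [Finset.mem_filter, Finset.mem_univ, true_and]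
    rfl
  · intro s hs r hr
    have : s = r := by
      by_contra h
      exact hr (by simp [mwt, costOne, h])
    exact this ▸ hs
  · intro n
    rw [hp n]
    refine ⟨?_, by simp [costOne]⟩
    simp only [minStates, costOne, Finset.mem_filter, Finset.mem_univ, true_and]
    exact ⟨⟨rfl, rfl⟩, by simp⟩

/-- A configuration with a finite value has a maximal dominant state, so that `domVal` is indeed a
maximum. -/
theorem domVal_isGreatest (A : WFA Q Γ) (c : AugState Q → WithTop ℤ) (h : ∃ q, c q ≠ ⊤) :
    IsGreatest {k : ℤ | ∃ q, A.IsDominant c q ∧ c q = k} (A.domVal c) := by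
  obtain ⟨q₀, hq₀⟩ := h
  have hfin : {k : ℤ | ∃ q, A.IsDominant c q ∧ c q = k}.Finite := by
    refine (Set.finite_range fun q => (c q).untopD 0).subset ?_
    rintro k ⟨q, -, hk⟩
    exact ⟨q, by simp [hk]⟩
  have hne : {k : ℤ | ∃ q, A.IsDominant c q ∧ c q = k}.Nonempty := by
    obtain ⟨q, -, hq⟩ := Finset.exists_min_image (Finset.univ : Finset (AugState Q)) c
      ⟨q₀, by simp⟩
    have hqt : c q ≠ ⊤ := ne_top_of_le_ne_top hq₀ (hq q₀ (by simp))
    obtain ⟨k, hk⟩ := WithTop.ne_top_iff_exists.1 hqt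
    refine ⟨k, q, ⟨hqt, [], .cactus
      (Finset.univ.filter fun s : AugState Q => s.base = q.base ∧ s.reach = q.reach) [],
      by simp, ⟨_, [], rfl, by simp, A.isStableCycle_nil q, by simp⟩, ⟨q, ?_⟩, ?_⟩, hk.symm⟩
    · have hp : costPow (A.mwt []) (bigM Q) = costOne := by
        rw [← mwt_pow]
        have : (List.replicate (bigM Q) ([] : List (Letter Q Γ))).flatten = [] := by simp
        rw [this, mwt]
      rw [List.nil_append, mwt, ← lt_top_iff_ne_top]
      refine lt_of_le_of_lt (Finset.inf_le (Finset.mem_univ q)) ?_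
      rw [letterCost, stabCost, if_pos (by simp), hp]
      refine WithTop.add_lt_top.2 ⟨?_, by simp [mwt, costOne]⟩
      refine lt_of_le_of_lt (Finset.inf_le (b := q) ?_) (by simp [costOne])
      simp [minStates, costOne]
    · intro p hp
      exact absurd hp (not_lt.2 (hq p (by simp)))
  exact ⟨hne.csSup_mem hfin, fun k hk => le_csSup hfin.bddAbove hk⟩

/-! ### Witnesses -/

/-- A type-0 witness `(w₁, α_{S₁, w₂}, w₃)` over the alphabet `boundedCac f`. For `f = simple` the
middle clause on `w₃` just says that all but its last letter belong to `boundedCacRebJump simple`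
(see `WFA.isTypeZeroWitness_simple_iff`). -/
def IsTypeZeroWitness (A : WFA Q Γ) (f : Flavour) (w₁ : List (Letter Q Γ))
    (S₁ : Finset (AugState Q)) (w₂ w₃ : List (Letter Q Γ)) : Prop :=
  (∀ a ∈ w₁, a ∈ A.boundedCac f) ∧ S₁ = A.ghost w₁ ∧ .cactus S₁ w₂ ∈ A.boundedCac f ∧
  (∃ z a, w₃ = z ++ [a] ∧
    (∀ b ∈ z, b ∈ A.boundedCac f ∪ A.boundedCacRebJump .simple) ∧
    a ∈ A.boundedCacRebCac .general) ∧
  A.reachable w₁ = A.reachable (w₁ ++ (List.replicate (2 * bigM Q) w₂).flatten) ∧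
  (∃ t, A.xconf (w₁ ++ (List.replicate (2 * bigM Q) w₂).flatten ++ w₃) t ≠ ⊤) ∧
  ∀ t, A.xconf (w₁ ++ [.cactus S₁ w₂] ++ w₃) t = ⊤

theorem isTypeZeroWitness_simple_iff (A : WFA Q Γ) (w₁ : List (Letter Q Γ))
    (S₁ : Finset (AugState Q)) (w₂ w₃ : List (Letter Q Γ)) :
    A.IsTypeZeroWitness .simple w₁ S₁ w₂ w₃ ↔
      (∀ a ∈ w₁, a ∈ A.boundedCac .simple) ∧ S₁ = A.ghost w₁ ∧
      .cactus S₁ w₂ ∈ A.boundedCac .simple ∧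
      (∃ z a, w₃ = z ++ [a] ∧ (∀ b ∈ z, b ∈ A.boundedCacRebJump .simple) ∧
        a ∈ A.boundedCacRebCac .general) ∧
      A.reachable w₁ = A.reachable (w₁ ++ (List.replicate (2 * bigM Q) w₂).flatten) ∧
      (∃ t, A.xconf (w₁ ++ (List.replicate (2 * bigM Q) w₂).flatten ++ w₃) t ≠ ⊤) ∧
      ∀ t, A.xconf (w₁ ++ [.cactus S₁ w₂] ++ w₃) t = ⊤ := by
  have h : A.boundedCac .simple ∪ A.boundedCacRebJump .simple = A.boundedCacRebJump .simple :=
    Set.union_eq_right.2 fun a ha => Or.inl (Or.inl ha)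
  rw [IsTypeZeroWitness, h]

/-! ### Separated repeating infixes -/

/-- The additive constant in the gap of a separated repeating infix: `0` in the simple case and the
constant `amp(|S|, 0)` of the simple functions in the general case. -/
def gapConst (A : WFA Q Γ) (f : Flavour) : ℕ := (A.params f).h

/-- `u x y v` is a separated repeating infix with respect to the length bound of flavour `f`. -/
structure IsSeparatedRepeatingInfix (A : WFA Q Γ) (f : Flavour) (u x y v : List (Letter Q Γ)) :
    Prop where
  letters : ∀ a ∈ u ++ x ++ y ++ v, a ∈ A.boundedCac f
  reach_x : A.reachable (u ++ x) = A.reachable u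
  reach_xy : A.reachable (u ++ x ++ y) = A.reachable u
  /-- `|x| ≤ L(dep(x) + 1) / m`. -/
  length_x : bigM Q * x.length ≤ A.lengthBound f (wordDepth x + 1)
  /-- `V 0, ..., V (ℓ - 1)` is a partition of the reachable states, with gaps larger than
  `4 |S| m maxEff(xy)` (plus a constant in the general case) between consecutive parts, and
  with all states of a part shifted by the same amounts upon reading `x` and `y`. -/
  partition : ∃ (ℓ : ℕ) (V : Fin ℓ → Finset (AugState Q)),
    (∀ j, (V j).Nonempty) ∧ (∀ i j, i ≠ j → Disjoint (V i) (V j)) ∧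
    (∀ s, s ∈ A.reachable u ↔ ∃ j, s ∈ V j) ∧
    (∀ i j : Fin ℓ, i.val + 1 = j.val → ∀ s ∈ V i, ∀ s' ∈ V j,
      ∀ ξ ∈ [u, u ++ x, u ++ x ++ y],
        A.xconf ξ s + ((4 * Fintype.card (AugState Q) * bigM Q * A.maxEff (x ++ y) +
          A.gapConst f : ℕ) : WithTop ℤ) < A.xconf ξ s') ∧
    ∀ j, ∃ kx ky : ℤ, kx.sign = ky.sign ∧ ∀ s ∈ V j,
      A.xconf (u ++ x) s = A.xconf u s + kx ∧
      A.xconf (u ++ x ++ y) s = A.xconf (u ++ x) s + ky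
  seamless : A.HasSeamlessBaseline (u ++ x ++ y ++ v)

/-- The monotonicity condition that makes a separated repeating infix a simple SRI (in terms of the
potential) or a general SRI (in terms of the charge). -/
def SRIMonotone (A : WFA Q Γ) (f : Flavour) (u x y : List (Letter Q Γ)) : Prop :=
  match f with
  | .simple =>
    A.potential u ≤ A.potential (u ++ x) ∧ A.potential (u ++ x) ≤ A.potential (u ++ x ++ y) ∧
      (A.potential u = A.potential (u ++ x) ↔ A.potential (u ++ x) = A.potential (u ++ x ++ y))
  | .general =>
    A.charge (u ++ x) ≤ A.charge u ∧ A.charge (u ++ x ++ y) ≤ A.charge (u ++ x) ∧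
      (A.charge u = A.charge (u ++ x) ↔ A.charge (u ++ x) = A.charge (u ++ x ++ y))

/-- `u x y v` is a simple SRI (`f = simple`) or a general SRI (`f = general`). -/
def IsSRI (A : WFA Q Γ) (f : Flavour) (u x y v : List (Letter Q Γ)) : Prop :=
  A.IsSeparatedRepeatingInfix f u x y v ∧ A.SRIMonotone f u x y

/-- `u x y v` is a non-degenerate stable SRI. -/
def IsNondegenerateStableSRI (A : WFA Q Γ) (f : Flavour) (u x y v : List (Letter Q Γ)) : Prop :=
  A.IsSRI f u x y v ∧ IsStableCycle (A.ghost u) (A.mwt x) ∧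
    ¬ IsDegenerate (A.ghost u) (A.mwt x)

end WFA

end

/-!
Let `c` be the configuration after `u`, `B` its support, and `α` the cactus letter of `x`.
Everything follows from one comparison: the configuration after `u x y` is nowhere above the one
after `u α`, and both agree on the baseline state.

*The comparison.* The word `x` shifts each of the separated classes of `B` by a constant
(`IsSeparatedShift`). The gaps between the classes exceed the effect of `x`, so that `x` never
leads to a higher class (`IsSeparatedShift.cls_le`) and every state has an optimal predecessor in
its own class (`IsSeparatedShift.exists_pred`). Following optimal predecessors one runs into a
cycle of weight a positive multiple of the shift; cycles of a stable cycle are not negative, so no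
class is shifted down (`IsSeparatedShift.shift_nonneg`). A run of `α` between two different
classes comes from a higher class and stays far above the values after `u x y`. A run of `α`
within one class passes through a state with a zero cycle on a power of `x`, which forces the
shift of the class by `x`, and by the sign condition also that by `y`, to be zero; then the run
cannot lead below the value in `c` (`IsSeparatedShift.le_add_stabCost`). The baseline state has a
zero cycle on `x`, hence lies in an unshifted class, and `α` keeps its value.

*Consequences.* The inequality persists when `v` is appended, which bounds configurations and
charge, and keeps the baseline run on `v` seamless (`WFA.SeamlessRun.exists_of_append`). For the
potential, take a suffix that makes a maximal dominant state after `u x y v` dominant. If it can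
be read after `u α v`, then the smallest state from which it can be read is dominant there, and
has at least the required value; if it cannot be read, then `v` and this suffix complete `u` and
`α` to a type-0 witness, as `x` preserves `B` (`WFA.potential_le_or_exists_suffix`).

*Membership in the alphabet.* Only the bound on the depth of `α` is not immediate. The runs on
`w ^ bigM Q` form a transitive relation (`costPow_bigM_trans`), and `α_{S', w}` keeps exactly those
of its strongly connected components that contain a minimal reflexive state. A non-degenerate
cycle loses at least one component (`IsSCCSeparated.exists_insert`), while a word has no more
components than any cactus letter that occurs in it (`WFA.exists_isSCCSeparated_of_mem`). Since
there are at most `|S|` components to begin with and at least one remains, the depth of `α` is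
less than `|S|`.
-/

/-! ### Walks and powers of min-plus matrices -/

section Walks

variable {α : Type*} [Fintype α]

theorem costMul_le (U V : α → α → WithTop ℤ) (s t r : α) :
    costMul U V s r ≤ U s t + V t r :=
  Finset.inf_le (Finset.mem_univ t)

theorem exists_costMul_eq (U V : α → α → WithTop ℤ) (s r : α) :
    ∃ t, costMul U V s r = U s t + V t r := by
  obtain ⟨t, -, ht⟩ := Finset.exists_mem_eq_inf (Finset.univ : Finset α) ⟨s, Finset.mem_univ s⟩
    (fun t => U s t + V t r)
  exact ⟨t, ht⟩

theorem costMul_ne_top_iff {U V : α → α → WithTop ℤ} {s r : α} :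
    costMul U V s r ≠ ⊤ ↔ ∃ t, U s t ≠ ⊤ ∧ V t r ≠ ⊤ := by
  constructor
  · intro h
    obtain ⟨t, ht⟩ := exists_costMul_eq U V s r
    rw [ht] at h
    exact ⟨t, WithTop.add_ne_top.1 h⟩
  · rintro ⟨t, h⟩
    exact ne_top_of_le_ne_top (WithTop.add_ne_top.2 h) (costMul_le U V s t r)

/-- Iterating a self-map of an `N`-element type `N * N!` times gives an idempotent map. -/
theorem iterate_card_mul_factorial_idem (φ : α → α) (a : α) :
    φ^[Fintype.card α * (Fintype.card α).factorial]
      (φ^[Fintype.card α * (Fintype.card α).factorial] a) =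
      φ^[Fintype.card α * (Fintype.card α).factorial] a := by
  set M := Fintype.card α * (Fintype.card α).factorial
  have hM : Fintype.card α ≤ M := Nat.le_mul_of_pos_right _ (Nat.factorial_pos _)
  obtain ⟨i, j, hij, hj, he⟩ : ∃ i j : ℕ, i < j ∧ j ≤ Fintype.card α ∧ φ^[i] a = φ^[j] a := by
    obtain ⟨i, j, hne, he⟩ := Fintype.exists_ne_map_eq_of_card_lt
      (fun i : Fin (Fintype.card α + 1) => φ^[i] a) (by simp)
    rcases lt_or_gt_of_ne hne with hlt | hlt
    · exact ⟨i, j, hlt, Nat.lt_succ_iff.1 j.2, he⟩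
    · exact ⟨j, i, hlt, Nat.lt_succ_iff.1 i.2, he.symm⟩
  have hper : Function.IsPeriodicPt φ (j - i) (φ^[M] a) := by
    have h1 : Function.IsPeriodicPt φ (j - i) (φ^[i] a) := by
      rw [Function.IsPeriodicPt, Function.IsFixedPt, ← Function.iterate_add_apply,
        show j - i + i = j by omega, he]
    rw [show M = (M - i) + i by omega, Function.iterate_add_apply]
    exact h1.apply_iterate _
  exact hper.trans_dvd ((Nat.dvd_factorial (by omega) (by omega)).mul_left _)

variable [DecidableEq α] (W : α → α → WithTop ℤ)

theorem costMul_one : costMul W costOne = W := by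
  funext s r
  apply le_antisymm
  · refine (costMul_le _ _ s r r).trans ?_
    simp [costOne]
  · refine Finset.le_inf fun t _ => ?_
    by_cases h : t = r
    · subst h; simp [costOne]
    · simp [costOne, h]

theorem costPow_one : costPow W 1 = W := costMul_one W

theorem costPow_add (a b : ℕ) :
    costPow W (a + b) = costMul (costPow W a) (costPow W b) := by
  induction a with
  | zero => rw [Nat.zero_add, costPow, costOne_mul]
  | succ a ih => rw [Nat.succ_add, costPow, ih, costPow, costMul_assoc]

theorem costPow_costPow (a n : ℕ) : costPow (costPow W a) n = costPow W (a * n) := by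
  induction n with
  | zero => rfl
  | succ n ih => rw [costPow, ih, Nat.mul_succ, Nat.add_comm, costPow_add]

variable {W}

theorem costPow_ne_top_trans {a b : ℕ} {s t r : α} (h : costPow W a s t ≠ ⊤)
    (h' : costPow W b t r ≠ ⊤) : costPow W (a + b) s r ≠ ⊤ := by
  rw [costPow_add]
  exact costMul_ne_top_iff.2 ⟨t, h, h'⟩

theorem exists_walk_of_costPow_ne_top {n : ℕ} {s r : α} (h : costPow W n s r ≠ ⊤) :
    ∃ p : ℕ → α, p 0 = s ∧ p n = r ∧ ∀ i < n, W (p i) (p (i + 1)) ≠ ⊤ := by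
  induction n generalizing s with
  | zero =>
    have : s = r := by
      by_contra hsr
      exact h (by simp [costPow, costOne, hsr])
    exact ⟨fun _ => s, rfl, this, by simp⟩
  | succ n ih =>
    obtain ⟨t, h1, h2⟩ := costMul_ne_top_iff.1 h
    obtain ⟨p, hp0, hpn, hp⟩ := ih h2
    refine ⟨fun i => Nat.casesOn i s p, rfl, hpn, ?_⟩
    rintro (_ | i) hi
    · simpa [hp0] using h1
    · exact hp i (by omega)

theorem costPow_ne_top_of_walk (p : ℕ → α) (a n : ℕ)
    (h : ∀ i, a ≤ i → i < a + n → W (p i) (p (i + 1)) ≠ ⊤) :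
    costPow W n (p a) (p (a + n)) ≠ ⊤ := by
  induction n generalizing a with
  | zero => simp [costPow, costOne]
  | succ n ih =>
    refine costMul_ne_top_iff.2 ⟨p (a + 1), h a le_rfl (by omega), ?_⟩
    have := ih (a + 1) fun i h1 h2 => h i (by omega) (by omega)
    rwa [show a + 1 + n = a + (n + 1) by omega] at this

/-- A walk with at least as many steps as there are states has a repetition within its first
`Fintype.card α` steps. -/
theorem exists_cycle_of_card_le {n : ℕ} {s r : α} (hn : Fintype.card α ≤ n)
    (h : costPow W n s r ≠ ⊤) : ∃ (t : α) (a c b : ℕ), 1 ≤ c ∧ c ≤ Fintype.card α ∧ a + c + b = n ∧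
      costPow W a s t ≠ ⊤ ∧ costPow W c t t ≠ ⊤ ∧ costPow W b t r ≠ ⊤ := by
  obtain ⟨p, rfl, rfl, hp⟩ := exists_walk_of_costPow_ne_top h
  obtain ⟨i, j, hij, hpij⟩ : ∃ i j : ℕ, i < j ∧ j ≤ Fintype.card α ∧ p i = p j := by
    obtain ⟨i, j, hne, he⟩ := Fintype.exists_ne_map_eq_of_card_lt
      (fun i : Fin (Fintype.card α + 1) => p i) (by simp)
    rcases lt_or_gt_of_ne hne with hlt | hlt
    · exact ⟨i, j, hlt, Nat.lt_succ_iff.1 j.2, he⟩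
    · exact ⟨j, i, hlt, Nat.lt_succ_iff.1 i.2, he.symm⟩
  refine ⟨p i, i, j - i, n - j, by omega, by omega, by omega, ?_, ?_, ?_⟩
  · simpa using costPow_ne_top_of_walk p 0 i fun k _ hk => hp k (by omega)
  · have := costPow_ne_top_of_walk p i (j - i) fun k _ hk => hp k (by omega)
    rwa [show i + (j - i) = j by omega, ← hpij.2] at this
  · have := costPow_ne_top_of_walk p j (n - j) fun k _ hk => hp k (by omega)
    rwa [show j + (n - j) = n by omega, ← hpij.2] at this

theorem exists_short_cycle {t : α} (c : ℕ) (hc : 1 ≤ c) (h : costPow W c t t ≠ ⊤) :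
    ∃ c', 1 ≤ c' ∧ c' ≤ Fintype.card α ∧ costPow W c' t t ≠ ⊤ := by
  induction c using Nat.strong_induction_on with
  | _ c ih =>
    by_cases hcN : c ≤ Fintype.card α
    · exact ⟨c, hc, hcN, h⟩
    · obtain ⟨t', a, d, b, hd, hdN, hsum, h1, -, h3⟩ := exists_cycle_of_card_le (by omega) h
      exact ih (a + b) (by omega) (by omega) (costPow_ne_top_trans h1 h3)

theorem costPow_self_ne_top {t : α} {c : ℕ} (h : costPow W c t t ≠ ⊤) (n : ℕ) :
    costPow W (c * n) t t ≠ ⊤ := by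
  induction n with
  | zero => simp [costPow, costOne]
  | succ n ih => exact costPow_ne_top_trans ih h

/-- With `N` states, every walk of length `k * N! ≥ N * N!` can be replaced by one of length
`N * N!`. Cycles are cut out until fewer than `N` blocks of length `N!` are left; the last one
that is cut out leaves a state on a closed walk, and such a state has a closed walk of length
`N!`, by which the length is filled up again. -/
theorem costPow_factorial_mul_card_ne_top (n : ℕ) {s r : α} (hn : Fintype.card α ≤ n)
    (h : costPow W ((Fintype.card α).factorial * n) s r ≠ ⊤) :
    costPow W ((Fintype.card α).factorial * Fintype.card α) s r ≠ ⊤ := by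
  induction n using Nat.strong_induction_on with
  | _ n ih =>
    rw [← costPow_costPow] at h
    obtain ⟨t, a, c, b, hc, -, hsum, h1, h2, h3⟩ := exists_cycle_of_card_le hn h
    by_cases hab : Fintype.card α ≤ a + b
    · refine ih (a + b) (by omega) hab ?_
      rw [← costPow_costPow]
      exact costPow_ne_top_trans h1 h3
    · have ht : costPow W (Fintype.card α).factorial t t ≠ ⊤ := by
        rw [costPow_costPow] at h2
        obtain ⟨c', hc1, hcN, hc'⟩ := exists_short_cycle _
          (Nat.mul_pos (Nat.factorial_pos _) hc) h2
        obtain ⟨k, hk⟩ := Nat.dvd_factorial hc1 hcN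
        rw [hk]
        exact costPow_self_ne_top hc' k
      have ht' := costPow_self_ne_top (W := costPow W (Fintype.card α).factorial)
        (c := 1) (t := t) (by rwa [costPow_one]) (Fintype.card α - (a + b))
      have := costPow_ne_top_trans (costPow_ne_top_trans h1 ht') h3
      rw [costPow_costPow] at this
      rwa [show a + 1 * (Fintype.card α - (a + b)) + b = Fintype.card α by omega] at this

theorem costPow_abs_le {e : ℤ} (he : ∀ s r (d : ℤ), W s r = d → |d| ≤ e) (n : ℕ) {s r : α} {d : ℤ}
    (h : costPow W n s r = d) : |d| ≤ n * e := by
  induction n generalizing s d with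
  | zero =>
    by_cases hsr : s = r
    · have : d = 0 := by simpa [costPow, costOne, hsr, eq_comm] using h
      simp [this]
    · simp [costPow, costOne, hsr] at h
  | succ n ih =>
    obtain ⟨t, ht⟩ := exists_costMul_eq W (costPow W n) s r
    obtain ⟨d₁, d₂, h1, h2, rfl⟩ := WithTop.add_eq_coe.1 (ht.symm.trans h)
    have h3 := he _ _ _ h1.symm
    have h4 := ih h2.symm
    push_cast
    linarith [abs_add_le d₁ d₂]

end Walks

/-! ### The depth of non-degenerate stable cycles -/

/-- A set of reflexive elements of `R`, no two of which are related in both directions. If `R` is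
transitive, such sets pick at most one element from each nontrivial strongly connected
component. -/
def IsSCCSeparated {α : Type*} (R : α → α → Prop) (X : Finset α) : Prop :=
  (∀ t ∈ X, R t t) ∧ ∀ t ∈ X, ∀ t' ∈ X, R t t' → R t' t → t = t'

/-- If every pair of the transitive relation `F` factors through a reflexive element of `F`, then
an `F`-separated set is obtained from any set separated for `P ∘ F ∘ R`. -/
theorem IsSCCSeparated.exists_of_comp {α : Type*} [DecidableEq α] {E P F R : α → α → Prop}
    (hE : ∀ s r, E s r ↔ ∃ s' r', P s s' ∧ F s' r' ∧ R r' r)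
    (htrans : ∀ s t r, F s t → F t r → F s r)
    (hfac : ∀ s r, F s r → ∃ g, F s g ∧ F g g ∧ F g r) {X : Finset α} (hX : IsSCCSeparated E X) :
    ∃ Y : Finset α, IsSCCSeparated F Y ∧ Y.card = X.card := by
  have h : ∀ t : α, ∃ g, t ∈ X → ∃ s' r', P t s' ∧ F s' g ∧ F g g ∧ F g r' ∧ R r' t := by
    intro t
    by_cases ht : t ∈ X
    · obtain ⟨s', r', h1, h2, h3⟩ := (hE t t).1 (hX.1 t ht)
      obtain ⟨g, h4, h5, h6⟩ := hfac _ _ h2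
      exact ⟨g, fun _ => ⟨s', r', h1, h4, h5, h6, h3⟩⟩
    · exact ⟨t, fun h => absurd h ht⟩
  choose g hg using h
  have key : ∀ t ∈ X, ∀ t' ∈ X, F (g t) (g t') → E t t' := by
    intro t ht t' ht' hF
    obtain ⟨s₁, r₁, h1, h2, h3, h4, h5⟩ := hg t ht
    obtain ⟨s₂, r₂, h6, h7, h8, h9, h10⟩ := hg t' ht'
    exact (hE t t').2 ⟨s₁, r₂, h1, htrans _ _ _ h2 (htrans _ _ _ hF h9), h10⟩
  have hrefl : ∀ t ∈ X, F (g t) (g t) := fun t ht => by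
    obtain ⟨_, _, _, _, h, _⟩ := hg t ht
    exact h
  refine ⟨X.image g, ⟨?_, ?_⟩, Finset.card_image_of_injOn ?_⟩
  · simpa using hrefl
  · simp only [Finset.mem_image]
    rintro _ ⟨t, ht, rfl⟩ _ ⟨t', ht', rfl⟩ h1 h2
    rw [hX.2 t ht t' ht' (key t ht t' ht' h1) (key t' ht' t ht h2)]
  · intro t ht t' ht' he
    have h1 : F (g t) (g t') := he ▸ hrefl t ht
    have h2 : F (g t') (g t) := he ▸ hrefl t ht
    exact hX.2 t ht t' ht' (key t ht t' ht' h1) (key t' ht' t ht h2)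

section StableCycles

variable {Q : Type*} [Fintype Q] [DecidableEq Q]
  {S' : Finset (AugState Q)} {W : AugState Q → AugState Q → WithTop ℤ}

theorem costPow_mul_bigM_ne_top {k : ℕ} (hk : 1 ≤ k) {s r : AugState Q}
    (h : costPow W (k * bigM Q) s r ≠ ⊤) : costPow W (bigM Q) s r ≠ ⊤ := by
  have := costPow_factorial_mul_card_ne_top (W := W) (k * Fintype.card (AugState Q)) (s := s)
    (r := r) (Nat.le_mul_of_pos_left _ hk) (by
      rwa [show (Fintype.card (AugState Q)).factorial * (k * Fintype.card (AugState Q)) =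
        k * bigM Q by rw [bigM]; ring])
  rwa [bigM, Nat.mul_comm]

/-- The relation of runs on `w ^ bigM Q` is transitive. -/
theorem costPow_bigM_trans {s t r : AugState Q} (h : costPow W (bigM Q) s t ≠ ⊤)
    (h' : costPow W (bigM Q) t r ≠ ⊤) : costPow W (bigM Q) s r ≠ ⊤ := by
  refine costPow_mul_bigM_ne_top (k := 2) (by omega) ?_
  rw [Nat.two_mul]
  exact costPow_ne_top_trans h h'

theorem stabCost_ne_top_iff {s r : AugState Q} :
    stabCost S' W s r ≠ ⊤ ↔ IsGrounded S' W s r := by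
  unfold stabCost IsGrounded
  split_ifs with h
  · rw [ne_eq, Finset.inf_eq_top_iff]
    simp only [h.1, h.2, true_and, not_forall, exists_prop, WithTop.add_eq_top, not_or, ne_eq]
  · simp only [ne_eq, not_true_eq_false, false_iff]
    exact fun h' => h ⟨h'.1, h'.2.1⟩

theorem IsGrounded.trans {s t r : AugState Q} (h : IsGrounded S' W s t)
    (h' : IsGrounded S' W t r) : IsGrounded S' W s r := by
  obtain ⟨hs, ht, g, hg, h1, h2⟩ := h
  obtain ⟨-, hr, g', hg', h3, h4⟩ := h'
  exact ⟨hs, hr, g, hg, h1, costPow_bigM_trans (costPow_bigM_trans h2 h3) h4⟩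

theorem IsGrounded.exists_reflexive {s r : AugState Q} (h : IsGrounded S' W s r) :
    ∃ g, IsGrounded S' W s g ∧ IsGrounded S' W g g ∧ IsGrounded S' W g r := by
  obtain ⟨hs, hr, g, hg, h1, h2⟩ := h
  have hg' := hg
  simp only [minStates, Finset.mem_filter] at hg'
  exact ⟨g, ⟨hs, hg'.1, g, hg, h1, hg'.2.1⟩, ⟨hg'.1, hg'.1, g, hg, hg'.2.1, hg'.2.1⟩,
    ⟨hg'.1, hr, g, hg, hg'.2.1, h2⟩⟩

/-- A non-degenerate cycle loses a strongly connected component when it is replaced by its cactus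
letter. -/
theorem IsSCCSeparated.exists_insert (hnd : ¬ IsDegenerate S' W) {X : Finset (AugState Q)}
    (hX : IsSCCSeparated (IsGrounded S' W) X) :
    ∃ Y : Finset (AugState Q),
      IsSCCSeparated (fun s r => costPow W (bigM Q) s r ≠ ⊤) Y ∧ Y.card = X.card + 1 := by
  unfold IsDegenerate at hnd
  push Not at hnd
  obtain ⟨s, hs, t, ht, htt, ⟨k, hk, hst⟩, hng⟩ := hnd
  have htt' : costPow W (bigM Q) t t ≠ ⊤ := costPow_mul_bigM_ne_top (by omega) htt
  have hst' : costPow W (bigM Q) s t ≠ ⊤ := by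
    refine costPow_mul_bigM_ne_top (k := 2 * k) (by omega) ?_
    rwa [show 2 * k * bigM Q = 2 * bigM Q * k by ring]
  have hsub : ∀ {p r}, IsGrounded S' W p r → costPow W (bigM Q) p r ≠ ⊤ := by
    rintro p r ⟨-, -, g, -, h1, h2⟩
    exact costPow_bigM_trans h1 h2
  -- `t` is not strongly connected to any reflexive state of the cactus letter.
  have hnot : ∀ r ∈ X, costPow W (bigM Q) t r ≠ ⊤ → costPow W (bigM Q) r t ≠ ⊤ → False := by
    intro r hr h1 h2
    obtain ⟨-, -, g, hg, h3, h4⟩ := hX.1 r hr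
    exact hng ⟨hs, ht, g, hg, costPow_bigM_trans (costPow_bigM_trans hst' h1) h3,
      costPow_bigM_trans h4 h2⟩
  have htX : t ∉ X := fun h => hnot t h htt' htt'
  refine ⟨insert t X, ⟨?_, ?_⟩, Finset.card_insert_of_notMem htX⟩
  · intro r hr
    rcases Finset.mem_insert.1 hr with rfl | hr
    · exact htt'
    · exact hsub (hX.1 r hr)
  · intro r hr r' hr' h1 h2
    rcases Finset.mem_insert.1 hr with rfl | hrX <;> rcases Finset.mem_insert.1 hr' with rfl | hrX'
    · rfl
    · exact (hnot r' hrX' h1 h2).elim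
    · exact (hnot r hrX h2 h1).elim
    · have hgr : ∀ {p q}, p ∈ X → q ∈ X → costPow W (bigM Q) p q ≠ ⊤ → IsGrounded S' W p q := by
        intro p q hp hq h
        obtain ⟨hpS, -, g, hg, h3, h4⟩ := hX.1 p hp
        exact ⟨hpS, (hX.1 q hq).1, g, hg, h3, costPow_bigM_trans h4 h⟩
      exact hX.2 r hrX r' hrX' (hgr hrX hrX' h1) (hgr hrX' hrX h2)

theorem bigM_pos (b : AugState Q) : 0 < bigM Q :=
  Nat.mul_pos (Fintype.card_pos_iff.2 ⟨b⟩) (Nat.factorial_pos _)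

end StableCycles

theorem exists_letter_depth_eq {Q Γ : Type*} (w : List (Letter Q Γ)) (h : 0 < wordDepth w) :
    ∃ a ∈ w, a.depth = wordDepth w := by
  induction w with
  | nil => simp [wordDepth] at h
  | cons a w ih =>
    rw [wordDepth] at h ⊢
    rcases le_total (wordDepth w) a.depth with hle | hle
    · exact ⟨a, by simp, by rw [max_eq_left hle]⟩
    · rw [max_eq_right hle] at h ⊢
      obtain ⟨b, hb, hd⟩ := ih h
      exact ⟨b, by simp [hb], hd⟩

namespace WFA

variable {Q Γ : Type*} [Fintype Q] [DecidableEq Q]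

/-- A set separated for the runs on `w ^ bigM Q` gives one of the same size for every cactus letter
occurring in `w`. -/
theorem exists_isSCCSeparated_of_mem (A : WFA Q Γ) {S' : Finset (AugState Q)}
    {z w : List (Letter Q Γ)} (b : AugState Q) (hz : Letter.cactus S' z ∈ w)
    {X : Finset (AugState Q)}
    (hX : IsSCCSeparated (fun s r => costPow (A.mwt w) (bigM Q) s r ≠ ⊤) X) :
    ∃ Y : Finset (AugState Q), IsSCCSeparated (IsGrounded S' (A.mwt z)) Y ∧ Y.card = X.card := by
  obtain ⟨p, q, rfl⟩ := List.append_of_mem hz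
  obtain ⟨n, hn⟩ := Nat.exists_eq_succ_of_ne_zero (bigM_pos b).ne'
  refine hX.exists_of_comp (P := fun s r => A.mwt p s r ≠ ⊤)
    (R := fun s r => costMul (A.mwt q) (costPow (A.mwt (p ++ .cactus S' z :: q)) n) s r ≠ ⊤)
    ?_ (fun _ _ _ => IsGrounded.trans) fun _ _ => IsGrounded.exists_reflexive
  intro s r
  have : costPow (A.mwt (p ++ .cactus S' z :: q)) (bigM Q) =
      costMul (A.mwt p) (costMul (stabCost S' (A.mwt z))
        (costMul (A.mwt q) (costPow (A.mwt (p ++ .cactus S' z :: q)) n))) := by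
    have hw : A.mwt (p ++ .cactus S' z :: q) =
        costMul (A.mwt p) (costMul (stabCost S' (A.mwt z)) (A.mwt q)) := by
      rw [A.mwt_append, mwt, letterCost]
    simp only [hn, costPow, hw, costMul_assoc]
  simp only [this, costMul_ne_top_iff, stabCost_ne_top_iff]
  constructor
  · rintro ⟨s', h1, r', h2, h3⟩
    exact ⟨s', r', h1, h2, h3⟩
  · rintro ⟨s', r', h1, h2, h3⟩
    exact ⟨s', h1, r', h2, h3⟩

variable [Fintype Γ]

/-- Each level of nesting of non-degenerate cycles costs one strongly connected component. -/
theorem IsBounded.card_add_depth_le {A : WFA Q Γ} {f : Flavour} {a : Letter Q Γ}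
    (ha : A.IsBounded f a) : ∀ S' w, a = .cactus S' w → ∀ X : Finset (AugState Q),
      IsSCCSeparated (IsGrounded S' (A.mwt w)) X →
        X.card + a.depth ≤ Fintype.card (AugState Q) := by
  induction ha with
  | base p σ q => simp
  | cactus S' w hw hst hnd _ ih =>
    rintro _ _ ⟨rfl, rfl⟩ X hX
    obtain ⟨Y, hY, hYX⟩ := hX.exists_insert hnd
    rw [Letter.depth]
    rcases Nat.eq_zero_or_pos (wordDepth w) with h0 | hpos
    · have := Finset.card_le_univ Y
      omega
    · obtain ⟨a, haw, had⟩ := exists_letter_depth_eq w hpos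
      have hab := hw a haw
      cases hab with
      | base p σ q =>
        rw [Letter.depth] at had
        omega
      | cactus S'' z _ _ _ _ =>
        obtain ⟨b, -⟩ := hst
        obtain ⟨Z, hZ, hZY⟩ := A.exists_isSCCSeparated_of_mem b haw hY
        have := ih _ haw S'' z rfl Z hZ
        omega

/-- The bound on the depth in `boundedCac` holds automatically for cactus letters. -/
theorem IsBounded.depth_cactus_lt {A : WFA Q Γ} {f : Flavour} {S' : Finset (AugState Q)}
    {w : List (Letter Q Γ)} (ha : A.IsBounded f (.cactus S' w)) :
    (Letter.cactus S' w).depth < Fintype.card (AugState Q) := by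
  have h := ha.card_add_depth_le S' w rfl
  cases ha with
  | cactus _ _ _ hst _ _ =>
    obtain ⟨b, -, -, -, hb⟩ := hst
    have hbm := (hb (bigM Q)).1
    have hbm' := hbm
    simp only [minStates, Finset.mem_filter] at hbm'
    have := h {b} ⟨by simpa using ⟨hbm'.1, hbm'.1, b, hbm, hbm'.2.1, hbm'.2.1⟩, by simp⟩
    rw [Finset.card_singleton] at this
    omega

end WFA

/-! ### Shifts of separated classes -/

/-- The matrix `W`, whose finite entries have absolute value at most `e`, turns a configuration
with support `B` and values `c` into one with the same support and with values
`c s + k (cls s)`: it shifts the classes `cls s = j`, each by a constant `k j`. Both before and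
after the shift, classes of larger index lie above those of smaller index, with gaps larger
than `D ≥ 2 * e`. -/
structure IsSeparatedShift {α : Type*} (W : α → α → WithTop ℤ) (B : Finset α) (cls : α → ℕ)
    (c : α → ℤ) (k : ℕ → ℤ) (e D : ℤ) : Prop where
  closed : ∀ p ∈ B, ∀ s, W p s ≠ ⊤ → s ∈ B
  entry_le : ∀ p s (d : ℤ), W p s = d → |d| ≤ e
  step : ∀ p ∈ B, ∀ s ∈ B, ∀ d : ℤ, W p s = d → c s + k (cls s) ≤ c p + d
  attained : ∀ s ∈ B, ∃ p ∈ B, ∃ d : ℤ, W p s = d ∧ c s + k (cls s) = c p + d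
  gap : ∀ s ∈ B, ∀ s' ∈ B, cls s < cls s' → c s + D < c s'
  gap_shift : ∀ s ∈ B, ∀ s' ∈ B, cls s < cls s' → c s + k (cls s) + D < c s' + k (cls s')
  two_mul_le : 2 * e ≤ D

namespace IsSeparatedShift

variable {α : Type*} {W : α → α → WithTop ℤ} {B : Finset α} {cls : α → ℕ} {c : α → ℤ}
  {k : ℕ → ℤ} {e D : ℤ}

/-- A state of largest value among those shifted up by more than `e` would have to be entered from
a higher class, which would be shifted up by more than `e` as well. -/
theorem shift_le (h : IsSeparatedShift W B cls c k e D) {s : α} (hs : s ∈ B) : k (cls s) ≤ e := by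
  by_contra hk
  obtain ⟨t, ht, hmax⟩ := Finset.exists_max_image (B.filter fun t => e < k (cls t)) c
    ⟨s, Finset.mem_filter.2 ⟨hs, not_le.1 hk⟩⟩
  obtain ⟨htB, htk⟩ := Finset.mem_filter.1 ht
  obtain ⟨p, hp, d, hd, heq⟩ := h.attained t htB
  have hde := abs_le.1 (h.entry_le _ _ _ hd)
  have hpk : k (cls p) ≤ e := by
    by_contra hpk
    have := hmax p (Finset.mem_filter.2 ⟨hp, not_le.1 hpk⟩)
    linarith
  have hD := h.two_mul_le
  rcases lt_trichotomy (cls p) (cls t) with hlt | heq' | hlt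
  · linarith [h.gap p hp t htB hlt]
  · rw [heq'] at hpk
    linarith
  · linarith [h.gap_shift t htB p hp hlt]

theorem neg_le_shift (h : IsSeparatedShift W B cls c k e D) {s : α} (hs : s ∈ B) :
    -e ≤ k (cls s) := by
  by_contra hk
  obtain ⟨t, ht, hmin⟩ := Finset.exists_min_image (B.filter fun t => k (cls t) < -e) c
    ⟨s, Finset.mem_filter.2 ⟨hs, not_le.1 hk⟩⟩
  obtain ⟨htB, htk⟩ := Finset.mem_filter.1 ht
  obtain ⟨p, hp, d, hd, heq⟩ := h.attained t htB
  have hde := abs_le.1 (h.entry_le _ _ _ hd)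
  have hpk : -e ≤ k (cls p) := by
    by_contra hpk
    have := hmin p (Finset.mem_filter.2 ⟨hp, not_le.1 hpk⟩)
    linarith
  have hD := h.two_mul_le
  rcases lt_trichotomy (cls p) (cls t) with hlt | heq' | hlt
  · linarith [h.gap_shift p hp t htB hlt]
  · rw [heq'] at hpk
    linarith
  · linarith [h.gap t htB p hp hlt]

theorem cls_le (h : IsSeparatedShift W B cls c k e D) {p s : α} (hp : p ∈ B) (hW : W p s ≠ ⊤) :
    cls s ≤ cls p := by
  by_contra hlt
  obtain ⟨d, hd⟩ := WithTop.ne_top_iff_exists.1 hW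
  have hs := h.closed p hp s hW
  linarith [h.gap_shift p hp s hs (not_le.1 hlt), h.step p hp s hs d hd.symm,
    abs_le.1 (h.entry_le _ _ _ hd.symm), h.neg_le_shift hp, h.two_mul_le]

theorem exists_pred (h : IsSeparatedShift W B cls c k e D) {s : α} (hs : s ∈ B) :
    ∃ p ∈ B, cls p = cls s ∧ W p s = ((c s - c p + k (cls s) : ℤ) : WithTop ℤ) := by
  obtain ⟨p, hp, d, hd, heq⟩ := h.attained s hs
  refine ⟨p, hp, le_antisymm ?_ (h.cls_le hp (by simp [hd])), by rw [hd]; congr 1; linarith⟩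
  by_contra hlt
  linarith [h.gap s hs p hp (not_le.1 hlt), abs_le.1 (h.entry_le _ _ _ hd), h.shift_le hs,
    h.two_mul_le]

variable [Fintype α] [DecidableEq α]

theorem costPow_closed (h : IsSeparatedShift W B cls c k e D) {n : ℕ} {p s : α} (hp : p ∈ B)
    (hW : costPow W n p s ≠ ⊤) : s ∈ B ∧ cls s ≤ cls p := by
  induction n generalizing p with
  | zero =>
    have : p = s := by
      by_contra hps
      exact hW (by simp [costPow, costOne, hps])
    exact this ▸ ⟨hp, le_rfl⟩
  | succ n ih =>
    obtain ⟨t, h1, h2⟩ := costMul_ne_top_iff.1 hW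
    obtain ⟨hs, hle⟩ := ih (h.closed p hp t h1) h2
    exact ⟨hs, hle.trans (h.cls_le hp h1)⟩

theorem costPow_step (h : IsSeparatedShift W B cls c k e D) {n : ℕ} {p s : α} (hp : p ∈ B)
    (hcls : cls p = cls s) {d : ℤ} (hW : costPow W n p s = d) :
    c s + n * k (cls s) ≤ c p + d := by
  induction n generalizing p d with
  | zero =>
    by_cases hps : p = s
    · have : d = 0 := by simpa [costPow, costOne, hps, eq_comm] using hW
      simp [hps, this]
    · simp [costPow, costOne, hps] at hW
  | succ n ih =>
    obtain ⟨t, ht⟩ := exists_costMul_eq W (costPow W n) p s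
    obtain ⟨d₁, d₂, h1, h2, rfl⟩ := WithTop.add_eq_coe.1 (ht.symm.trans hW)
    have h1' : W p t ≠ ⊤ := by simp [← h1]
    have htB := h.closed p hp t h1'
    have htp := h.cls_le hp h1'
    have hst := (h.costPow_closed htB (n := n) (s := s) (by simp [← h2])).2
    have hts : cls t = cls s := by omega
    have h3 := h.step p hp t htB d₁ h1.symm
    have h4 := ih htB hts h2.symm
    rw [hts] at h3
    push_cast
    linarith

/-- Following optimal predecessors within the class of `s`, one runs into a cycle, along which
every transition contributes the shift of the class. -/
theorem exists_costPow_self_le (h : IsSeparatedShift W B cls c k e D) {s : α} (hs : s ∈ B) :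
    ∃ g ∈ B, costPow W (Fintype.card α * (Fintype.card α).factorial) g g ≤
      (((Fintype.card α * (Fintype.card α).factorial : ℕ) * k (cls s) : ℤ) : WithTop ℤ) := by
  have hex : ∀ t, ∃ p, t ∈ B →
      p ∈ B ∧ cls p = cls t ∧ W p t = ((c t - c p + k (cls t) : ℤ) : WithTop ℤ) := by
    intro t
    by_cases ht : t ∈ B
    · obtain ⟨p, hp⟩ := h.exists_pred ht
      exact ⟨p, fun _ => hp⟩
    · exact ⟨t, fun h => absurd h ht⟩
  choose φ hφ using hex
  have key : ∀ n : ℕ, ∀ t ∈ B, φ^[n] t ∈ B ∧ cls (φ^[n] t) = cls t ∧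
      costPow W n (φ^[n] t) t ≤ ((c t - c (φ^[n] t) + n * k (cls t) : ℤ) : WithTop ℤ) := by
    intro n
    induction n with
    | zero => intro t ht; simp [ht, costPow, costOne]
    | succ n ih =>
      intro t ht
      obtain ⟨h1, h2, h3⟩ := ih t ht
      obtain ⟨h4, h5, h6⟩ := hφ _ h1
      rw [Function.iterate_succ_apply']
      refine ⟨h4, h5.trans h2, (costMul_le _ _ _ (φ^[n] t) _).trans ?_⟩
      rw [h6]
      refine (add_le_add_right h3 _).trans ?_
      rw [← WithTop.coe_add, WithTop.coe_le_coe, h2]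
      push_cast
      linarith
  obtain ⟨h1, h2, -⟩ := key (Fintype.card α * (Fintype.card α).factorial) s hs
  refine ⟨_, h1, ?_⟩
  obtain ⟨-, -, h4⟩ := key (Fintype.card α * (Fintype.card α).factorial) _ h1
  rw [iterate_card_mul_factorial_idem, h2] at h4
  simpa using h4

end IsSeparatedShift

/-! ### The configuration reached by the cactus letter -/

section Cactus

variable {Q : Type*} [Fintype Q] [DecidableEq Q] {S' : Finset (AugState Q)}
  {W : AugState Q → AugState Q → WithTop ℤ}

theorem IsStableCycle.nonneg_of_costPow_self (h : IsStableCycle S' W) {n : ℕ} {s : AugState Q}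
    (hs : s ∈ S') {d : ℤ} (hd : costPow W n s s = d) : 0 ≤ d := by
  obtain ⟨b, -, -, -, hb⟩ := h
  obtain ⟨hmin, h0⟩ := hb n
  simp only [minStates, Finset.mem_filter] at hmin
  have := hmin.2.2 s hs (by simp [hd])
  rw [h0, hd] at this
  exact_mod_cast this

theorem IsStableCycle.mem_minStates_iff (h : IsStableCycle S' W) {n : ℕ} {s : AugState Q} :
    s ∈ minStates S' (costPow W n) ↔ s ∈ S' ∧ costPow W n s s = 0 := by
  have hnn := fun (t) (ht : t ∈ S') (d) => h.nonneg_of_costPow_self (n := n) (s := t) ht (d := d)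
  obtain ⟨b, -, -, -, hb⟩ := h
  obtain ⟨hmin, h0⟩ := hb n
  simp only [minStates, Finset.mem_filter] at hmin ⊢
  constructor
  · rintro ⟨hs, hne, hle⟩
    refine ⟨hs, le_antisymm (h0 ▸ hle b hmin.1 hmin.2.1) (h0 ▸ hmin.2.2 s hs hne)⟩
  · rintro ⟨hs, h1⟩
    refine ⟨hs, by simp [h1], fun r hr hne => ?_⟩
    rw [h1, ← h0]
    exact hmin.2.2 r hr hne

variable {B : Finset (AugState Q)} {cls : AugState Q → ℕ} {c : AugState Q → ℤ} {k : ℕ → ℤ}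
  {e D : ℤ}

/-- In a stable cycle no class is shifted downwards, since a class contains a cycle whose weight
is a positive multiple of the shift. -/
theorem IsSeparatedShift.shift_nonneg (h : IsSeparatedShift W B cls c k e D)
    (hst : IsStableCycle S' W) (hB : B ⊆ S') {s : AugState Q} (hs : s ∈ B) : 0 ≤ k (cls s) := by
  obtain ⟨g, hg, h1⟩ := h.exists_costPow_self_le hs
  obtain ⟨d, hd⟩ := WithTop.ne_top_iff_exists.1 (ne_top_of_le_ne_top WithTop.coe_ne_top h1)
  have h0 := hst.nonneg_of_costPow_self (hB hg) hd.symm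
  rw [← hd, WithTop.coe_le_coe] at h1
  exact nonneg_of_mul_nonneg_right (h0.trans h1) (by exact_mod_cast bigM_pos s)

/-- The cactus letter of a stable cycle with matrix `W` does not lead below the shift by a matrix
`V` that, like `x y` in comparison with `x`, does not shift the classes that `W` does not shift. A
run that changes its class comes from above and cannot bridge the gap. A run within a class passes
through a state with a zero cycle, so that neither `W` nor `V` shifts the class. -/
theorem IsSeparatedShift.le_add_stabCost (h : IsSeparatedShift W B cls c k e D)
    (hst : IsStableCycle S' W) {V : AugState Q → AugState Q → WithTop ℤ}
    {k' : ℕ → ℤ} {e' : ℤ} (h' : IsSeparatedShift V B cls c k' e' D)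
    (hB : B ⊆ S') (hk : ∀ s ∈ B, k (cls s) = 0 → k' (cls s) = 0)
    (hD : 2 * bigM Q * e + e' ≤ D) {s r : AugState Q} (hs : s ∈ B) {d : ℤ}
    (hd : stabCost S' W s r = d) : r ∈ B ∧ c r + k' (cls r) ≤ c s + d := by
  obtain ⟨g, hg, hsg⟩ : ∃ g ∈ minStates S' (costPow W (bigM Q)),
      costPow W (bigM Q) s g + costPow W (bigM Q) g r = d := by
    have hS : s ∈ S' ∧ r ∈ S' := by
      by_contra hS
      simp [stabCost, hS] at hd
    rw [stabCost, if_pos hS] at hd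
    have hne : (minStates S' (costPow W (bigM Q))).Nonempty := by
      by_contra hne
      simp [Finset.not_nonempty_iff_eq_empty.1 hne] at hd
    obtain ⟨g, hg, hinf⟩ := Finset.exists_mem_eq_inf _ hne
      fun g => costPow W (bigM Q) s g + costPow W (bigM Q) g r
    exact ⟨g, hg, hinf ▸ hd⟩
  obtain ⟨d₁, d₂, h1, h2, rfl⟩ := WithTop.add_eq_coe.1 hsg
  obtain ⟨hgB, hgs⟩ := h.costPow_closed hs (n := bigM Q) (s := g) (by simp [← h1])
  obtain ⟨hrB, hrg⟩ := h.costPow_closed hgB (n := bigM Q) (s := r) (by simp [← h2])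
  refine ⟨hrB, ?_⟩
  rcases (hrg.trans hgs).lt_or_eq with hlt | heq
  · have h3 := abs_le.1 (costPow_abs_le h.entry_le _ h1.symm)
    have h4 := abs_le.1 (costPow_abs_le h.entry_le _ h2.symm)
    linarith [h.gap r hrB s hs hlt, h'.shift_le hrB]
  · have hgr : cls g = cls r := by omega
    have hm : (0 : ℤ) < bigM Q := by exact_mod_cast bigM_pos s
    have hgg := (hst.mem_minStates_iff.1 hg).2
    have h3 := h.costPow_step hgB rfl (d := 0) (by simpa using hgg)
    have hk0 : k (cls g) = 0 := by
      refine le_antisymm ?_ (h.shift_nonneg hst hB hgB)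
      by_contra hpos
      nlinarith [mul_pos hm (not_le.1 hpos)]
    have h4 := h.costPow_step hs (by omega) h1.symm
    have h5 := h.costPow_step hgB hgr h2.symm
    rw [hk0] at h4
    rw [← hgr, hk0] at h5
    rw [← hgr, hk g hgB hk0]
    linarith

end Cactus

/-! ### Configurations and their effects -/

namespace WFA

section Configurations

variable {Q Γ : Type*} [Fintype Q] [DecidableEq Q] (A : WFA Q Γ)

theorem letterCost_abs_le {a : Letter Q Γ} {s r : AugState Q} {d : ℤ}
    (h : A.letterCost a s r = d) : |d| ≤ A.letterMaxWeight a := by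
  have h1 : d.natAbs ≤ A.letterMaxWeight a := by
    refine le_trans ?_ (Finset.le_sup (Finset.mem_univ s))
    refine le_trans ?_ (Finset.le_sup (Finset.mem_univ r))
    simp [h]
  rw [Int.abs_eq_natAbs]
  exact_mod_cast h1

theorem mwt_abs_le {w : List (Letter Q Γ)} {s r : AugState Q} {d : ℤ}
    (h : A.mwt w s r = d) : |d| ≤ A.maxEff w := by
  have hrun := A.isRun_of_mwt h
  clear h
  induction hrun with
  | nil => simp
  | @cons a w s t r c d h1 _ ih =>
    have h2 := A.letterCost_abs_le h1
    simp only [maxEff, List.map_cons, List.sum_cons, Nat.cast_add] at ih ⊢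
    linarith [abs_add_le c d]

theorem maxEff_append (w z : List (Letter Q Γ)) :
    A.maxEff (w ++ z) = A.maxEff w + A.maxEff z := by
  simp [maxEff]

theorem mwt_singleton (a : Letter Q Γ) : A.mwt [a] = A.letterCost a := by
  rw [mwt, mwt, costMul_one]

theorem xconf_append (w z : List (Letter Q Γ)) :
    A.xconf (w ++ z) = costMul (A.mwt w) (A.mwt z) A.augInit := by
  rw [xconf, mwt_append]

theorem xconf_append_le (w z : List (Letter Q Γ)) (s r : AugState Q) :
    A.xconf (w ++ z) r ≤ A.xconf w s + A.mwt z s r := by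
  rw [xconf_append]
  exact costMul_le _ _ _ s r

theorem exists_xconf_append_eq (w z : List (Letter Q Γ)) (r : AugState Q) :
    ∃ s, A.xconf (w ++ z) r = A.xconf w s + A.mwt z s r := by
  rw [xconf_append]
  exact exists_costMul_eq _ _ _ r

theorem xconf_append_ne_top_iff {w z : List (Letter Q Γ)} {r : AugState Q} :
    A.xconf (w ++ z) r ≠ ⊤ ↔ ∃ s, A.xconf w s ≠ ⊤ ∧ A.mwt z s r ≠ ⊤ := by
  rw [xconf_append, costMul_ne_top_iff]
  rfl

theorem xconf_append_mono {w w' : List (Letter Q Γ)} (h : ∀ s, A.xconf w s ≤ A.xconf w' s)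
    (z : List (Letter Q Γ)) (r : AugState Q) : A.xconf (w ++ z) r ≤ A.xconf (w' ++ z) r := by
  obtain ⟨s, hs⟩ := A.exists_xconf_append_eq w' z r
  rw [hs]
  exact (A.xconf_append_le w z s r).trans (add_le_add_left (h s) _)

theorem mem_reachable {w : List (Letter Q Γ)} {s : AugState Q} :
    s ∈ A.reachable w ↔ A.xconf w s ≠ ⊤ := by
  simp only [reachable, Finset.mem_filter, Finset.mem_univ, true_and]

theorem reachable_append_congr {w w' : List (Letter Q Γ)} (h : A.reachable w = A.reachable w')
    (z : List (Letter Q Γ)) : A.reachable (w ++ z) = A.reachable (w' ++ z) := by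
  ext r
  simp only [mem_reachable, xconf_append_ne_top_iff]
  simp only [← mem_reachable, h]

theorem reachable_append_pow {w x : List (Letter Q Γ)} (h : A.reachable (w ++ x) = A.reachable w)
    (n : ℕ) : A.reachable (w ++ (List.replicate n x).flatten) = A.reachable w := by
  induction n with
  | zero => simp
  | succ n ih =>
    rw [List.replicate_succ, List.flatten_cons, ← List.append_assoc,
      A.reachable_append_congr h, ih]

theorem reachable_subset_ghost (w : List (Letter Q Γ)) : A.reachable w ⊆ A.ghost w := by
  intro s hs
  simp only [ghost, Finset.mem_filter, Finset.mem_univ, true_and]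
  exact ⟨s, hs, rfl, rfl⟩

/-- Reading `z` from the configuration of `u` is a separated shift if it preserves the support,
the order of the classes, and the values within each class up to constants. -/
theorem isSeparatedShift {u z : List (Letter Q Γ)} (hB : A.reachable (u ++ z) = A.reachable u)
    {cls : AugState Q → ℕ} {k : ℕ → ℤ} {D : ℕ}
    (hk : ∀ s ∈ A.reachable u, A.xconf (u ++ z) s = A.xconf u s + k (cls s))
    (hgap : ∀ s ∈ A.reachable u, ∀ s' ∈ A.reachable u, cls s < cls s' →
      ∀ ξ ∈ [u, u ++ z], A.xconf ξ s + (D : WithTop ℤ) < A.xconf ξ s')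
    (hD : 2 * A.maxEff z ≤ D) :
    IsSeparatedShift (A.mwt z) (A.reachable u) cls (fun s => (A.xconf u s).untopD 0) k
      (A.maxEff z) D := by
  have hc : ∀ s ∈ A.reachable u, A.xconf u s = (((A.xconf u s).untopD 0 : ℤ) : WithTop ℤ) := by
    intro s hs
    obtain ⟨d, hd⟩ := WithTop.ne_top_iff_exists.1 (A.mem_reachable.1 hs)
    simp [← hd]
  refine ⟨?_, fun p s d h => A.mwt_abs_le h, ?_, ?_, ?_, ?_, by exact_mod_cast hD⟩
  · intro p hp s hs
    rw [← hB, mem_reachable, xconf_append_ne_top_iff]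
    exact ⟨p, A.mem_reachable.1 hp, hs⟩
  · intro p hp s hs d hd
    have h := A.xconf_append_le u z p s
    rw [hk s hs, hc s hs, hc p hp, hd] at h
    exact_mod_cast h
  · intro s hs
    obtain ⟨p, h⟩ := A.exists_xconf_append_eq u z s
    rw [hk s hs, hc s hs, ← WithTop.coe_add] at h
    obtain ⟨d₁, d, h1, h2, h3⟩ := WithTop.add_eq_coe.1 h.symm
    refine ⟨p, A.mem_reachable.2 (by simp [← h1]), d, h2.symm, ?_⟩
    simp only [← h1, WithTop.untopD_coe]
    exact h3.symm
  · intro s hs s' hs' hlt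
    have h := hgap s hs s' hs' hlt u (by simp)
    rw [hc s hs, hc s' hs'] at h
    exact_mod_cast h
  · intro s hs s' hs' hlt
    have h := hgap s hs s' hs' hlt (u ++ z) (by simp)
    rw [hk s hs, hk s' hs', hc s hs, hc s' hs'] at h
    exact_mod_cast h

end Configurations

/-! ### Seamless baseline runs -/

section Seamless

variable {Q Γ : Type*} [Fintype Q] [DecidableEq Q]

/-- `A.SeamlessRun w s`: there is a seamless baseline run on `w` that ends in `s`. The condition on
the weights of prefixes is stated for one letter at a time. -/
inductive SeamlessRun (A : WFA Q Γ) : List (Letter Q Γ) → AugState Q → Prop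
  | nil : SeamlessRun A [] A.augInit
  | snoc {w : List (Letter Q Γ)} {a : Letter Q Γ} {s r : AugState Q} :
      SeamlessRun A w s → r.IsBaseline → A.letterCost a s r ≠ ⊤ →
      A.xconf w s + A.letterCost a s r = A.xconf (w ++ [a]) r → SeamlessRun A (w ++ [a]) r

variable {A : WFA Q Γ}

theorem SeamlessRun.isBaseline {w : List (Letter Q Γ)} {s : AugState Q}
    (h : A.SeamlessRun w s) : s.IsBaseline := by
  cases h with
  | nil => rfl
  | snoc _ h => exact h

theorem SeamlessRun.xconf_ne_top {w : List (Letter Q Γ)} {s : AugState Q}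
    (h : A.SeamlessRun w s) : A.xconf w s ≠ ⊤ := by
  induction h with
  | nil => simp [xconf, mwt, costOne]
  | snoc _ _ h1 h2 ih =>
    rw [← h2]
    exact WithTop.add_ne_top.2 ⟨ih, h1⟩

theorem SeamlessRun.exists_of_snoc {w : List (Letter Q Γ)} {a : Letter Q Γ} {r : AugState Q}
    (h : A.SeamlessRun (w ++ [a]) r) : ∃ s, A.SeamlessRun w s ∧ r.IsBaseline ∧
      A.letterCost a s r ≠ ⊤ ∧ A.xconf w s + A.letterCost a s r = A.xconf (w ++ [a]) r := by
  generalize hz : w ++ [a] = z at h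
  cases h with
  | nil => simp at hz
  | @snoc w' a' s _ h1 h2 h3 h4 =>
    obtain ⟨rfl, ha⟩ := List.append_inj' hz rfl
    obtain rfl : a = a' := by simpa using ha
    exact ⟨s, h1, h2, h3, h4⟩

theorem sum_filter_lt_succ {M : Type*} [AddCommMonoid M] {n : ℕ} (F : Fin n → M) {j : ℕ}
    (hj : j < n) :
    ∑ i : Fin n with i.val < j + 1, F i = (∑ i : Fin n with i.val < j, F i) + F ⟨j, hj⟩ := by
  have : (Finset.univ.filter fun i : Fin n => i.val < j + 1) =
      insert ⟨j, hj⟩ (Finset.univ.filter fun i : Fin n => i.val < j) := by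
    ext i
    simp only [Finset.mem_filter, Finset.mem_univ, true_and, Finset.mem_insert, Fin.ext_iff]
    omega
  rw [this, Finset.sum_insert (by simp), add_comm]

theorem hasSeamlessBaseline_iff_stepwise {w : List (Letter Q Γ)} :
    A.HasSeamlessBaseline w ↔ ∃ ρ : ℕ → AugState Q, ρ 0 = A.augInit ∧
      (∀ i ≤ w.length, (ρ i).IsBaseline) ∧ ∀ i (hi : i < w.length),
        A.letterCost w[i] (ρ i) (ρ (i + 1)) ≠ ⊤ ∧
        A.xconf (w.take i) (ρ i) + A.letterCost w[i] (ρ i) (ρ (i + 1)) =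
          A.xconf (w.take (i + 1)) (ρ (i + 1)) := by
  constructor
  · rintro ⟨ρ, h0, hb, hne, hsum⟩
    refine ⟨ρ, h0, hb, fun i hi => ⟨hne ⟨i, hi⟩, ?_⟩⟩
    rw [← hsum i hi.le, ← hsum (i + 1) hi, sum_filter_lt_succ _ hi]
    rfl
  · rintro ⟨ρ, h0, hb, hstep⟩
    refine ⟨ρ, h0, hb, fun i => (hstep i i.2).1, fun j => ?_⟩
    induction j with
    | zero => intro _; simp [h0, xconf, mwt, costOne]
    | succ j ih =>
      intro hj
      rw [sum_filter_lt_succ _ hj, ih (by omega)]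
      exact (hstep j hj).2

theorem hasSeamlessBaseline_iff_exists {w : List (Letter Q Γ)} :
    A.HasSeamlessBaseline w ↔ ∃ s, A.SeamlessRun w s := by
  rw [hasSeamlessBaseline_iff_stepwise]
  constructor
  · rintro ⟨ρ, h0, hb, hstep⟩
    have : ∀ j ≤ w.length, A.SeamlessRun (w.take j) (ρ j) := by
      intro j
      induction j with
      | zero => intro _; simpa [h0] using SeamlessRun.nil
      | succ j ih =>
        intro hj
        have h := hstep j hj
        rw [List.take_succ_eq_append_getElem hj] at h ⊢
        exact (ih (by omega)).snoc (hb _ hj) h.1 h.2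
    exact ⟨_, by simpa using this w.length le_rfl⟩
  · rintro ⟨s, h⟩
    suffices ∃ ρ : ℕ → AugState Q, ρ w.length = s ∧ ρ 0 = A.augInit ∧
        (∀ i ≤ w.length, (ρ i).IsBaseline) ∧ ∀ i (hi : i < w.length),
          A.letterCost w[i] (ρ i) (ρ (i + 1)) ≠ ⊤ ∧
          A.xconf (w.take i) (ρ i) + A.letterCost w[i] (ρ i) (ρ (i + 1)) =
            A.xconf (w.take (i + 1)) (ρ (i + 1)) by
      obtain ⟨ρ, -, hρ⟩ := this
      exact ⟨ρ, hρ⟩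
    induction h with
    | nil => exact ⟨fun _ => A.augInit, rfl, rfl, fun _ _ => rfl, by simp⟩
    | @snoc w a s r _ hr h1 h2 ih =>
      obtain ⟨ρ, hs, h0, hb, hstep⟩ := ih
      have hle : ∀ i ≤ w.length, Function.update ρ (w.length + 1) r i = ρ i := fun i hi =>
        Function.update_of_ne (by omega) _ _
      refine ⟨Function.update ρ (w.length + 1) r, by simp, by rw [hle 0 (by omega), h0], ?_, ?_⟩
      · intro i hi
        rcases Nat.lt_or_ge w.length i with hlt | hge
        · have : i = w.length + 1 := by simp at hi; omega
          simpa [this] using hr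
        · rw [hle i hge]
          exact hb i hge
      · intro i hi
        rcases Nat.lt_or_ge i w.length with hlt | hge
        · rw [hle i hlt.le, hle (i + 1) hlt, List.getElem_append_left hlt,
            List.take_append_of_le_length hlt.le, List.take_append_of_le_length hlt]
          exact hstep i hlt
        · obtain rfl : i = w.length := by simp at hi; omega
          rw [hle _ le_rfl, hs]
          rw [List.take_of_length_le (i := w.length + 1) (by simp)]
          simpa using ⟨h1, h2⟩

/-- A seamless baseline run on `w ++ v` continues a run on `w`. Its second part also continues a
seamless baseline run on another word `w'` with the same end and the same value there, if `w'`
leads to a configuration that is nowhere smaller than that of `w`. -/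
theorem SeamlessRun.exists_of_append {w : List (Letter Q Γ)} (v : List (Letter Q Γ)) :
    ∀ {r : AugState Q}, A.SeamlessRun (w ++ v) r → ∃ s, A.SeamlessRun w s ∧
      ∀ w', A.SeamlessRun w' s → (∀ t, A.xconf w t ≤ A.xconf w' t) →
        A.xconf w' s = A.xconf w s →
        A.SeamlessRun (w' ++ v) r ∧ A.xconf (w' ++ v) r = A.xconf (w ++ v) r := by
  induction v using List.reverseRecOn with
  | nil =>
    intro r h
    rw [List.append_nil] at h
    exact ⟨r, h, fun w' h1 _ h2 => by simpa using ⟨h1, h2⟩⟩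
  | append_singleton v a ih =>
    intro r h
    rw [← List.append_assoc] at h
    obtain ⟨t, ht, hr, hne, heq⟩ := h.exists_of_snoc
    obtain ⟨s, hs, hcont⟩ := ih ht
    refine ⟨s, hs, fun w' h1 h2 h3 => ?_⟩
    obtain ⟨h4, h5⟩ := hcont w' h1 h2 h3
    simp only [← List.append_assoc]
    have h6 : A.xconf (w' ++ v ++ [a]) r = A.xconf (w ++ v ++ [a]) r := by
      refine le_antisymm ?_ ?_
      · have := A.xconf_append_le (w' ++ v) [a] t r
        rwa [h5, mwt_singleton, heq] at this
      · simpa only [List.append_assoc] using A.xconf_append_mono h2 (v ++ [a]) r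
    exact ⟨h4.snoc hr hne (by rw [h5, heq, h6]), h6⟩

end Seamless

/-! ### Charge and potential -/

section Potential

variable {Q Γ : Type*} [Fintype Q] [DecidableEq Q] {A : WFA Q Γ}

theorem charge_le_charge {w w' : List (Letter Q Γ)} (h : ∀ s, A.xconf w s ≤ A.xconf w' s)
    (hne : ∃ s, A.xconf w' s ≠ ⊤) : A.charge w' ≤ A.charge w := by
  obtain ⟨s, hs⟩ := hne
  have hle : Finset.univ.inf (A.xconf w) ≤ Finset.univ.inf (A.xconf w') :=
    Finset.inf_mono_fun fun t _ => h t
  have htop : Finset.univ.inf (A.xconf w') ≠ ⊤ :=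
    ne_top_of_le_ne_top hs (Finset.inf_le (Finset.mem_univ s))
  obtain ⟨d', hd'⟩ := WithTop.ne_top_iff_exists.1 htop
  obtain ⟨d, hd⟩ := WithTop.ne_top_iff_exists.1 (ne_top_of_le_ne_top htop hle)
  rw [← hd, ← hd', WithTop.coe_le_coe] at hle
  simp only [charge, ← hd, ← hd', WithTop.untopD_coe]
  exact neg_le_neg hle

variable [Fintype Γ]

/-- The potential can decrease from `w` to a word `w'` with a larger configuration only if a suffix
that can be read after `w` cannot be read after `w'`: otherwise take a suffix that makes a maximal
dominant state of `w` dominant, and a smallest state of `w'` from which this suffix can be read.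
This state is dominant after `w'`, and its value is at least that of the dominant state of `w`. -/
theorem potential_le_or_exists_suffix {w w' : List (Letter Q Γ)}
    (h : ∀ s, A.xconf w s ≤ A.xconf w' s) (hne : ∃ s, A.xconf w s ≠ ⊤) :
    A.potential w ≤ A.potential w' ∨ ∃ z a, (∀ b ∈ z, b ∈ A.boundedCacRebJump .simple) ∧
      a ∈ A.boundedCacRebCac .general ∧ (∃ t, A.xconf (w ++ (z ++ [a])) t ≠ ⊤) ∧
      ∀ t, A.xconf (w' ++ (z ++ [a])) t = ⊤ := by
  obtain ⟨q, ⟨hq, z, a, hz, ha, ⟨t, ht⟩, hdom⟩, hφ⟩ := (A.domVal_isGreatest _ hne).1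
  by_cases hread : ∃ t, A.xconf (w' ++ (z ++ [a])) t ≠ ⊤
  · left
    obtain ⟨t', ht'⟩ := hread
    obtain ⟨p, hp, hpt⟩ := A.xconf_append_ne_top_iff.1 ht'
    classical
    obtain ⟨r, hr, hmin⟩ := Finset.exists_min_image
      (Finset.univ.filter fun r => ∃ t, A.mwt (z ++ [a]) r t ≠ ⊤) (A.xconf w')
      ⟨p, Finset.mem_filter.2 ⟨Finset.mem_univ _, t', hpt⟩⟩
    simp only [Finset.mem_filter, Finset.mem_univ, true_and] at hr hmin
    have hrt : A.xconf w' r ≠ ⊤ := ne_top_of_le_ne_top hp (hmin p ⟨t', hpt⟩)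
    obtain ⟨d, hd⟩ := WithTop.ne_top_iff_exists.1 hrt
    have hdomr : A.IsDominant (A.xconf w') r := by
      refine ⟨hrt, z, a, hz, ha, hr, fun p' hp' t => ?_⟩
      by_contra hne
      exact absurd (hmin p' ⟨t, hne⟩) (not_le.2 hp')
    have h1 : d ≤ A.potential w' := (A.domVal_isGreatest _ ⟨r, hrt⟩).2 ⟨r, hdomr, hd.symm⟩
    have h2 : A.xconf w q ≤ A.xconf w r := by
      by_contra hlt
      obtain ⟨t, ht⟩ := hr
      exact ht (hdom r (not_le.1 hlt) t)
    have h3 := h2.trans (h r)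
    rw [hφ, ← hd, WithTop.coe_le_coe] at h3
    exact le_trans h3 h1
  · right
    push Not at hread
    exact ⟨z, a, hz, ha, ⟨t, A.xconf_append_ne_top_iff.2 ⟨q, hq, ht⟩⟩, hread⟩

end Potential

/-! ### Separated repeating infixes -/

section RepeatingInfix

variable {Q Γ : Type*} [Fintype Q] [DecidableEq Q] [Fintype Γ] {A : WFA Q Γ} {f : Flavour}
  {u x y v : List (Letter Q Γ)}

theorem IsSeparatedRepeatingInfix.exists_cls (h : A.IsSeparatedRepeatingInfix f u x y v) :
    ∃ (cls : AugState Q → ℕ) (kx ky : ℕ → ℤ),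
      (∀ j, (kx j).sign = (ky j).sign) ∧
      (∀ s ∈ A.reachable u, A.xconf (u ++ x) s = A.xconf u s + kx (cls s) ∧
        A.xconf (u ++ x ++ y) s = A.xconf (u ++ x) s + ky (cls s)) ∧
      ∀ s ∈ A.reachable u, ∀ s' ∈ A.reachable u, cls s < cls s' →
        ∀ ξ ∈ [u, u ++ x, u ++ x ++ y],
          A.xconf ξ s + ((4 * Fintype.card (AugState Q) * bigM Q * A.maxEff (x ++ y) +
            A.gapConst f : ℕ) : WithTop ℤ) < A.xconf ξ s' := by
  obtain ⟨ℓ, V, hne, -, hB, hgap, hk⟩ := h.partition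
  choose kx ky hsign hk using hk
  have hex : ∀ s, ∃ j : ℕ, s ∈ A.reachable u → ∃ hj : j < ℓ, s ∈ V ⟨j, hj⟩ := by
    intro s
    by_cases hs : s ∈ A.reachable u
    · obtain ⟨j, hj⟩ := (hB s).1 hs
      exact ⟨j, fun _ => ⟨j.2, hj⟩⟩
    · exact ⟨0, fun h => absurd h hs⟩
  choose cls hcls using hex
  -- Gaps between consecutive classes add up, since no class in between is empty.
  have hgap' : ∀ n : ℕ, ∀ i j : Fin ℓ, i.val + n + 1 = j.val → ∀ s ∈ V i, ∀ s' ∈ V j,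
      ∀ ξ ∈ [u, u ++ x, u ++ x ++ y],
        A.xconf ξ s + ((4 * Fintype.card (AugState Q) * bigM Q * A.maxEff (x ++ y) +
          A.gapConst f : ℕ) : WithTop ℤ) < A.xconf ξ s' := by
    intro n
    induction n with
    | zero => exact hgap
    | succ n ih =>
      intro i j hij s hs s' hs' ξ hξ
      have hi : i.val + n + 1 < ℓ := by omega
      obtain ⟨t, ht⟩ := hne ⟨i.val + n + 1, hi⟩
      refine (ih i ⟨_, hi⟩ rfl s hs t ht ξ hξ).trans_le ?_
      refine le_trans ?_ (hgap ⟨_, hi⟩ j (by simpa [add_assoc] using hij) t ht s' hs' ξ hξ).le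
      exact le_add_of_nonneg_right (by positivity)
  refine ⟨cls, fun j => if hj : j < ℓ then kx ⟨j, hj⟩ else 0,
    fun j => if hj : j < ℓ then ky ⟨j, hj⟩ else 0, ?_, ?_, ?_⟩
  · intro j
    by_cases hj : j < ℓ
    · simpa only [hj, dif_pos] using hsign _
    · simp only [hj, dif_neg, not_false_eq_true]
  · intro s hs
    obtain ⟨hj, hsV⟩ := hcls s hs
    simpa only [hj, dif_pos] using hk _ s hsV
  · intro s hs s' hs' hlt ξ hξ
    obtain ⟨hj, hsV⟩ := hcls s hs
    obtain ⟨hj', hsV'⟩ := hcls s' hs'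
    exact hgap' (cls s' - cls s - 1) _ _ (by simp only; omega) s hsV s' hsV' ξ hξ

/-- Replacing the infix `x y` by the cactus letter of its stable cycle `x` does not decrease the
configuration, and preserves the value of the baseline state, in which all seamless baseline runs
on `u`, on `u x y` and on `u` followed by the cactus letter end. -/
theorem IsNondegenerateStableSRI.cactus_seamless (h : A.IsNondegenerateStableSRI f u x y v) :
    (∀ r, A.xconf (u ++ x ++ y) r ≤ A.xconf (u ++ [.cactus (A.ghost u) x]) r) ∧
    ∀ s, A.SeamlessRun (u ++ x ++ y) s →
      A.SeamlessRun (u ++ [.cactus (A.ghost u) x]) s ∧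
      A.xconf (u ++ [.cactus (A.ghost u) x]) s = A.xconf (u ++ x ++ y) s := by
  obtain ⟨⟨hsri, -⟩, hst, -⟩ := h
  obtain ⟨cls, kx, ky, hsign, hk, hgap⟩ := hsri.exists_cls
  have hBS := A.reachable_subset_ghost u
  have hcard : 1 ≤ Fintype.card (AugState Q) := Fintype.card_pos_iff.2 ⟨A.augInit⟩
  have hm : 1 ≤ bigM Q := bigM_pos A.augInit
  set D := 4 * Fintype.card (AugState Q) * bigM Q * A.maxEff (x ++ y) + A.gapConst f with hDdef
  have hD : 4 * bigM Q * A.maxEff (x ++ y) ≤ D := by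
    refine le_trans ?_ (Nat.le_add_right _ _)
    gcongr
    omega
  have heff : A.maxEff x ≤ A.maxEff (x ++ y) := by
    rw [maxEff_append]
    omega
  have hmeff : A.maxEff (x ++ y) ≤ bigM Q * A.maxEff (x ++ y) := Nat.le_mul_of_pos_left _ hm
  have hmx : bigM Q * A.maxEff x ≤ bigM Q * A.maxEff (x ++ y) := Nat.mul_le_mul_left _ heff
  rw [Nat.mul_assoc] at hD
  have hX := A.isSeparatedShift (z := x) hsri.reach_x (k := kx) (fun s hs => (hk s hs).1)
    (fun s hs s' hs' hlt ξ hξ => hgap s hs s' hs' hlt ξ (by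
      simp only [List.mem_cons, List.not_mem_nil, or_false] at hξ ⊢
      tauto)) (by omega)
  have hXY := A.isSeparatedShift (z := x ++ y) (cls := cls) (k := fun j => kx j + ky j) (D := D)
    (by rw [← List.append_assoc]; exact hsri.reach_xy)
    (fun s hs => by
      rw [← List.append_assoc, (hk s hs).2, (hk s hs).1, add_assoc, WithTop.coe_add])
    (fun s hs s' hs' hlt ξ hξ => hgap s hs s' hs' hlt ξ (by
      simp only [List.mem_cons, List.not_mem_nil, or_false, ← List.append_assoc] at hξ ⊢
      tauto)) (by omega)
  have hc : ∀ s ∈ A.reachable u, A.xconf u s = (((A.xconf u s).untopD 0 : ℤ) : WithTop ℤ) := by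
    intro s hs
    obtain ⟨d, hd⟩ := WithTop.ne_top_iff_exists.1 (A.mem_reachable.1 hs)
    simp [← hd]
  have hkxy : ∀ j, kx j = 0 → kx j + ky j = 0 := by
    intro j hj
    have := hsign j
    rw [hj, Int.sign_zero, eq_comm, Int.sign_eq_zero_iff_zero] at this
    rw [hj, this, add_zero]
  have hle : ∀ r, A.xconf (u ++ x ++ y) r ≤ A.xconf (u ++ [.cactus (A.ghost u) x]) r := by
    intro r
    obtain ⟨s, hs⟩ := A.exists_xconf_append_eq u [.cactus (A.ghost u) x] r
    rw [mwt_singleton, letterCost] at hs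
    by_cases htop : A.xconf u s + stabCost (A.ghost u) (A.mwt x) s r = ⊤
    · rw [hs, htop]
      exact le_top
    · obtain ⟨h1, h2⟩ := WithTop.add_ne_top.1 htop
      obtain ⟨d, hd⟩ := WithTop.ne_top_iff_exists.1 h2
      have hsB := A.mem_reachable.2 h1
      obtain ⟨hr, h3⟩ := hX.le_add_stabCost hst hXY hBS (fun s _ => hkxy _)
        (by
          have : 2 * bigM Q * A.maxEff x + A.maxEff (x ++ y) ≤ D := by
            rw [Nat.mul_assoc]
            omega
          exact_mod_cast this) hsB hd.symm
      rw [hs, (hk r hr).2, (hk r hr).1, hc r hr, hc s hsB, ← hd]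
      rw [← add_assoc] at h3
      exact_mod_cast h3
  refine ⟨hle, fun s hs => ?_⟩
  obtain ⟨b, hbase, hS, -, hb⟩ := id hst
  -- The states in question are baseline states of `ghost u`, of which there is only one.
  have huniq : ∀ t ∈ A.reachable u, t.IsBaseline → t = b := by
    intro t ht htb
    obtain ⟨h1, h2⟩ := (hS t).1 (hBS ht)
    have h3 : t.inner = b.inner := by rw [htb, h1, hbase]
    exact Subtype.ext (Prod.ext h3 (Prod.ext h1 h2))
  obtain rfl : s = b :=
    huniq s (hsri.reach_xy ▸ A.mem_reachable.2 hs.xconf_ne_top) hs.isBaseline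
  have hu : A.SeamlessRun u s := by
    rw [List.append_assoc] at hs
    obtain ⟨t, ht, -⟩ := hs.exists_of_append
    exact huniq t (A.mem_reachable.2 ht.xconf_ne_top) ht.isBaseline ▸ ht
  have hsB := A.mem_reachable.2 hu.xconf_ne_top
  have hk0 : kx (cls s) = 0 := by
    refine le_antisymm ?_ (hX.shift_nonneg hst hBS hsB)
    have h1 := (hb 1).2
    rw [costPow_one] at h1
    have := hX.step s hsB s hsB 0 (by simpa using h1)
    linarith
  have hcost : stabCost (A.ghost u) (A.mwt x) s s ≤ 0 := by
    rw [stabCost, if_pos ⟨hBS hsB, hBS hsB⟩]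
    refine (Finset.inf_le (hb (bigM Q)).1).trans ?_
    rw [(hb (bigM Q)).2, add_zero]
  have hxy : A.xconf (u ++ x ++ y) s = A.xconf u s := by
    have := hkxy _ hk0
    rw [(hk s hsB).2, (hk s hsB).1, hc s hsB]
    norm_cast
    rw [add_assoc, this, add_zero]
  have h1 : A.xconf (u ++ [.cactus (A.ghost u) x]) s ≤
      A.xconf u s + stabCost (A.ghost u) (A.mwt x) s s := by
    have := A.xconf_append_le u [.cactus (A.ghost u) x] s s
    rwa [mwt_singleton, letterCost] at this
  have h2 : A.xconf u s + stabCost (A.ghost u) (A.mwt x) s s ≤ A.xconf u s :=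
    add_le_of_nonpos_right hcost
  have h3 := hle s
  rw [hxy] at h3 ⊢
  refine ⟨hu.snoc hbase ?_ ?_, le_antisymm (h1.trans h2) h3⟩
  · rw [letterCost]
    exact ne_top_of_le_ne_top WithTop.zero_ne_top hcost
  · rw [letterCost]
    exact le_antisymm (h2.trans h3) h1

theorem IsNondegenerateStableSRI.cactus_mem_boundedCac (h : A.IsNondegenerateStableSRI f u x y v) :
    Letter.cactus (A.ghost u) x ∈ A.boundedCac f := by
  obtain ⟨⟨hsri, -⟩, hst, hnd⟩ := h
  have hb : A.IsBounded f (.cactus (A.ghost u) x) :=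
    .cactus _ _ (fun a ha => (hsri.letters a (by simp [ha])).1) hst hnd
      ((Nat.le_mul_of_pos_left _ (bigM_pos A.augInit)).trans hsri.length_x)
  exact ⟨hb, hb.depth_cactus_lt⟩

end RepeatingInfix

end WFA

theorem mainTheorem11 {Q Γ : Type*} [Fintype Q] [DecidableEq Q] [Fintype Γ] (A : WFA Q Γ)
    (f : Flavour) (u x y v : List (Letter Q Γ)) (h : A.IsNondegenerateStableSRI f u x y v)
    (w w' : List (Letter Q Γ)) (hw : w = u ++ x ++ y ++ v)
    (hw' : w' = u ++ [Letter.cactus (A.ghost u) x] ++ v) :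
    (∀ a ∈ w', a ∈ A.boundedCac f) ∧
    A.HasSeamlessBaseline w' ∧
    (∀ t, A.mwt w A.augInit t ≤ A.mwt w' A.augInit t) ∧
    A.charge w' ≤ A.charge w ∧
    ∀ g : Flavour, (∀ a ∈ w ++ w', a ∈ A.boundedCac g) →
      (∃ w₁ S₁ w₂ w₃, A.IsTypeZeroWitness g w₁ S₁ w₂ w₃) ∨ A.potential w ≤ A.potential w' := by
  subst hw hw'
  have hsri := h.1.1
  obtain ⟨hle, hrun⟩ := h.cactus_seamless
  obtain ⟨r, hr⟩ := WFA.hasSeamlessBaseline_iff_exists.1 hsri.seamless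
  obtain ⟨s, hs, hcont⟩ := hr.exists_of_append
  obtain ⟨hs', heq⟩ := hrun s hs
  have hr' := (hcont _ hs' hle heq).1
  have hlev := A.xconf_append_mono hle v
  refine ⟨?_, WFA.hasSeamlessBaseline_iff_exists.2 ⟨r, hr'⟩, hlev,
    WFA.charge_le_charge hlev ⟨r, hr'.xconf_ne_top⟩, ?_⟩
  · intro a ha
    simp only [List.mem_append, List.mem_singleton] at ha
    rcases ha with (ha | rfl) | ha
    · exact hsri.letters a (by simp [ha])
    · exact h.cactus_mem_boundedCac
    · exact hsri.letters a (by simp [ha])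
  · intro g hg
    refine (WFA.potential_le_or_exists_suffix hlev ⟨r, hr.xconf_ne_top⟩).symm.imp_left ?_
    rintro ⟨z, a, hz, ha, ⟨t, ht⟩, hnone⟩
    have hpow := A.reachable_append_pow hsri.reach_x (2 * bigM Q)
    refine ⟨u, _, x, v ++ (z ++ [a]), fun b hb => hg b (by simp [hb]), rfl, hg _ (by simp),
      ⟨v ++ z, a, by simp, fun b hb => ?_, ha⟩, hpow.symm, ⟨t, ?_⟩, fun t => ?_⟩
    · rcases List.mem_append.1 hb with hb | hb
      · exact Or.inl (hg b (by simp [hb]))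
      · exact Or.inr (hz b hb)
    · rw [← WFA.mem_reachable, A.reachable_append_congr (hpow.trans hsri.reach_xy.symm),
        WFA.mem_reachable, ← List.append_assoc]
      exact ht
    · rw [← List.append_assoc]
      exact hnone t
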